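/- Let $M$ be a smooth (finite-dimensional, Hausdorff, second countable) manifold and let $A\to M$ be a real Lie algebroid of rank $N$, with anchor $\rho$, bracket $[\,,]$ of sections, differential $d_A$ on $\Gamma(\wedge^\bullet A^*)$ and Lie derivative $\mathcal L^A$. For $\pi\in\Gamma(\wedge^2A)$ let $\pi^\sharp:A^*\to A$ be given by $\langle\beta,\pi^\sharp\alpha\rangle=\pi(\alpha,\beta)$, and let $i_\pi$ be the interior product by $\pi$, with $i_{X\wedge Y}=i_X\circ i_Y$. Let $\psi\in\Gamma(\wedge^3A^*)$, and assume that $(\pi,\psi)$ is a twisted Poisson structure on $A$, i.e. $$d_A\psi=0,\qquad \tfrac12[\pi,\pi]=(\wedge^3\pi^\sharp)\psi .$$ Consider the Lie algebroid $A^*$ with anchor $\rho\circ\pi^\sharp$ and bracket $$[\alpha,\beta]_{\pi,\psi}=\mathcal L^A_{\pi^\sharp\alpha}\beta-\mathcal L^A_{\pi^\sharp\beta}\alpha-d_A(\pi(\alpha,\beta))+\psi(\pi^\sharp\alpha,\pi^\sharp\beta,\cdot\,),$$ and let $d_{\pi,\psi}$ be its Lie algebroid differential: $\langle\alpha,d_{\pi,\psi}f\rangle=\rho(\pi^\sharp\alpha)\cdot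 f$ for $f\in C^\infty(M)$, and, for $Z\in\Gamma(A)$, $$(d_{\pi,\psi}Z)(\alpha,\beta)=\rho(\pi^\sharp\alpha)\cdot\langle\beta,Z\rangle-\rho(\pi^\sharp\beta)\cdot\langle\alpha,Z\rangle-\langle[\alpha,\beta]_{\pi,\psi},Z\rangle .$$ Let $Y_{\pi,\psi}\in\Gamma(A)$ be the section such that, for every $\alpha\in\Gamma(A^*)$, $\langle\alpha,Y_{\pi,\psi}\rangle$ is one half of the trace of the endomorphism $\beta\mapsto\psi(\pi^\sharp\alpha,\pi^\sharp\beta,\cdot\,)$ of $A^*$. For every volume form (nowhere vanishing section of $\wedge^NA^*$) or, whether or not $A$ is orientable, every nowhere vanishing smooth density $\lambda$ on $A$, there is a unique section $X_{\pi,\lambda}$ of $A$ such that $$\langle\alpha,X_{\pi,\lambda}\rangle\,\lambda=\mathcal L^A_{\pi^\sharp\alpha}\lambda-(i_\pi d_A\alpha)\,\lambda\qquad\text{for all }\alpha\in\Gamma(A^*).$$ Then the section $Z_{\pi,\psi,\lambda}=X_{\pi,\lambda}+Y_{\pi,\psi}$ is a $d_{\pi,\psi}$-cocycle, and its class in the first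 Lie algebroid cohomology of $A^*$ does not depend on the choice of the volume form or density $\lambda$. (This class is the modular class of $(A,\pi,\psi)$.) -/

import Mathlib

open scoped Manifold ContDiff


set_option linter.unusedSectionVars false

noncomputable section

namespace TwistedPoisson

/-! ### Lie-Rinehart calculus

`R` plays the role of the ring of smooth functions and `L` that of the module of smooth sections of
a Lie algebroid; `⁅a, b⁆` is the bracket of sections and `⁅a, f⁆` is the derivative of the function
`f` along the anchor of `a`.  Sections of the dual bundle are elements of `Module.Dual R L`,
`p`-vectors are elements of `⋀[R]^p L` and `q`-forms are elements of `⋀[R]^q (Module.Dual R L)`. -/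

section Algebra

variable {R L : Type*} [CommRing R] [AddCommGroup L] [Module R L]

/-- The value of a `q`-form on `q` sections; `ξ₁ ∧ … ∧ ξ_q` has the value `det (ξ_j (v_i))`. -/
def evalForm {q : ℕ} (η : ⋀[R]^q (Module.Dual R L)) : L [⋀^Fin q]→ₗ[R] R :=
  (exteriorPower.pairingDual R L q η).compAlternatingMap (exteriorPower.ιMulti R q)

/-- A bilinear map vanishing on the diagonal, as an alternating map. -/
def alternatingOfBilin {N : Type*} [AddCommGroup N] [Module R N] (B : L →ₗ[R] L →ₗ[R] N)
    (hB : ∀ x, B x x = 0) : L [⋀^Fin 2]→ₗ[R] N where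
  toFun v := B (v 0) (v 1)
  map_update_add' v i x y := by
    fin_cases i <;> simp [Function.update]
  map_update_smul' v i c x := by
    fin_cases i <;> simp [Function.update]
  map_eq_zero_of_eq' v i j h hij := by
    fin_cases i <;> fin_cases j <;> simp_all

/-- The linear map on bivectors with `X ∧ Y ↦ B X Y`. -/
def liftBivector {N : Type*} [AddCommGroup N] [Module R N] (B : L →ₗ[R] L →ₗ[R] N)
    (hB : ∀ x, B x x = 0) : ⋀[R]^2 L →ₗ[R] N :=
  exteriorPower.alternatingMapLinearEquiv (alternatingOfBilin B hB)

theorem liftBivector_wedge {N : Type*} [AddCommGroup N] [Module R N] (B : L →ₗ[R] L →ₗ[R] N)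
    (hB : ∀ x, B x x = 0) (X Y : L) :
    liftBivector B hB (exteriorPower.ιMulti R 2 ![X, Y]) = B X Y := by
  simp [liftBivector, alternatingOfBilin]

/-- `π ↦ π♯`, with `⟨β, π♯ α⟩ = π(α, β)`; thus `(X ∧ Y)♯ α = α(X) Y - α(Y) X`. -/
def sharp : ⋀[R]^2 L →ₗ[R] (Module.Dual R L →ₗ[R] L) :=
  liftBivector
    (LinearMap.mk₂ R
      (fun X Y => (Module.Dual.eval R L X).smulRight Y - (Module.Dual.eval R L Y).smulRight X)
      (by intros; ext; simp [add_smul]; abel)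
      (by intros; ext; simp [mul_smul, smul_sub]; rw [smul_comm])
      (by intros; ext; simp [add_smul]; abel)
      (by intros; ext; simp [mul_smul, smul_sub]; rw [smul_comm]))
    (by intro X; simp)

theorem sharp_wedge (X Y : L) (α : Module.Dual R L) :
    sharp (exteriorPower.ιMulti R 2 ![X, Y]) α = α X • Y - α Y • X := by
  simp [sharp, liftBivector_wedge]

/-- The interior product `i_π η` of a `2`-form by a bivector, where `i_{X ∧ Y} = i_X ∘ i_Y`:
`i_{X ∧ Y} η = η(Y, X) = -η(X, Y)`. -/
def contractTwoForm (π : ⋀[R]^2 L) (η : L [⋀^Fin 2]→ₗ[R] R) : R :=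
  -(exteriorPower.alternatingMapLinearEquiv η π)

section

variable {N : Type*} [AddCommGroup N] [Module R N] (f : L [⋀^Fin 3]→ₗ[R] N) (r : R)
  (a a' b b' c c' : L)

theorem update_vec₁ : Function.update ![a, b, c] 0 a' = ![a', b, c] := by
  ext i; fin_cases i <;> rfl

theorem update_vec₂ : Function.update ![a, b, c] 1 b' = ![a, b', c] := by
  ext i; fin_cases i <;> rfl

theorem update_vec₃ : Function.update ![a, b, c] 2 c' = ![a, b, c'] := by
  ext i; fin_cases i <;> rfl

theorem alternating_add₁ : f ![a + a', b, c] = f ![a, b, c] + f ![a', b, c] := by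
  have h := f.map_update_add ![a, b, c] 0 a a'
  simpa only [update_vec₁] using h

theorem alternating_add₂ : f ![a, b + b', c] = f ![a, b, c] + f ![a, b', c] := by
  have h := f.map_update_add ![a, b, c] 1 b b'
  simpa only [update_vec₂] using h

theorem alternating_add₃ : f ![a, b, c + c'] = f ![a, b, c] + f ![a, b, c'] := by
  have h := f.map_update_add ![a, b, c] 2 c c'
  simpa only [update_vec₃] using h

theorem alternating_smul₁ : f ![r • a, b, c] = r • f ![a, b, c] := by
  have h := f.map_update_smul ![a, b, c] 0 r a
  simpa only [update_vec₁] using h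

theorem alternating_smul₂ : f ![a, r • b, c] = r • f ![a, b, c] := by
  have h := f.map_update_smul ![a, b, c] 1 r b
  simpa only [update_vec₂] using h

theorem alternating_smul₃ : f ![a, b, r • c] = r • f ![a, b, c] := by
  have h := f.map_update_smul ![a, b, c] 2 r c
  simpa only [update_vec₃] using h

end

/-- The `1`-form `V ↦ η(X, Y, V)`. -/
def insertTwo (η : L [⋀^Fin 3]→ₗ[R] R) (X Y : L) : Module.Dual R L where
  toFun V := η ![X, Y, V]
  map_add' V W := alternating_add₃ η X Y V W
  map_smul' c V := alternating_smul₃ η c X Y V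

/-- The `1`-form `⟨η, π ∧ ·⟩`; for `π = X ∧ Y` it is `V ↦ η(X, Y, V)`. -/
def insertBivector (η : L [⋀^Fin 3]→ₗ[R] R) : ⋀[R]^2 L →ₗ[R] Module.Dual R L :=
  liftBivector
    (LinearMap.mk₂ R (insertTwo η)
      (fun X X' Y => LinearMap.ext fun V => alternating_add₁ η X X' Y V)
      (fun c X Y => LinearMap.ext fun V => alternating_smul₁ η c X Y V)
      (fun X Y Y' => LinearMap.ext fun V => alternating_add₂ η X Y Y' V)
      (fun c X Y => LinearMap.ext fun V => alternating_smul₂ η c X Y V))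
    (fun X => LinearMap.ext fun V =>
      η.map_eq_zero_of_eq ![X, X, V] (i := 0) (j := 1) rfl (by decide))

theorem insertBivector_wedge (η : L [⋀^Fin 3]→ₗ[R] R) (X Y V : L) :
    insertBivector η (exteriorPower.ιMulti R 2 ![X, Y]) V = η ![X, Y, V] := by
  simp [insertBivector, liftBivector_wedge, insertTwo]

end Algebra

/-! ### The Schouten (Gerstenhaber) bracket of bivectors -/

section LieRinehart

variable {R L : Type*} [CommRing R] [LieRing L] [Module R L]

/-- `a ∧ b ∧ c`. -/
def wedge₃ (a b c : L) : ⋀[R]^3 L := exteriorPower.ιMulti R 3 ![a, b, c]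

variable (R) in
/-- The bracket of two decomposable bivectors,
`[a₁ ∧ a₂, b₁ ∧ b₂] = ∑ₖₗ (-1)^(k+l) [aₖ, bₗ] ∧ (remaining factors)`. -/
def schoutenDecomposable (a₁ a₂ b₁ b₂ : L) : ⋀[R]^3 L :=
  wedge₃ ⁅a₁, b₁⁆ a₂ b₂ - wedge₃ ⁅a₁, b₂⁆ a₂ b₁ - wedge₃ ⁅a₂, b₁⁆ a₁ b₂ + wedge₃ ⁅a₂, b₂⁆ a₁ b₁

section
variable (a a' b b' c c' : L) (r : R)

theorem wedge₃_add₁ : (wedge₃ (a + a') b c : ⋀[R]^3 L) = wedge₃ a b c + wedge₃ a' b c :=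
  alternating_add₁ _ a a' b c

theorem wedge₃_add₂ : (wedge₃ a (b + b') c : ⋀[R]^3 L) = wedge₃ a b c + wedge₃ a b' c :=
  alternating_add₂ _ a b b' c

theorem wedge₃_add₃ : (wedge₃ a b (c + c') : ⋀[R]^3 L) = wedge₃ a b c + wedge₃ a b c' :=
  alternating_add₃ _ a b c c'

theorem wedge₃_smul₁ : (wedge₃ (r • a) b c : ⋀[R]^3 L) = r • wedge₃ a b c :=
  alternating_smul₁ _ r a b c

theorem wedge₃_smul₂ : (wedge₃ a (r • b) c : ⋀[R]^3 L) = r • wedge₃ a b c :=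
  alternating_smul₂ _ r a b c

theorem wedge₃_smul₃ : (wedge₃ a b (r • c) : ⋀[R]^3 L) = r • wedge₃ a b c :=
  alternating_smul₃ _ r a b c

theorem wedge₃_swap₁₂ : (wedge₃ b a c : ⋀[R]^3 L) = -wedge₃ a b c := by
  have h := (exteriorPower.ιMulti R 3).map_swap ![a, b, c] (i := 0) (j := 1) (by decide)
  rw [wedge₃, wedge₃, ← h]
  congr 1
  ext i; fin_cases i <;> rfl

theorem wedge₃_swap₂₃ : (wedge₃ a c b : ⋀[R]^3 L) = -wedge₃ a b c := by
  have h := (exteriorPower.ιMulti R 3).map_swap ![a, b, c] (i := 1) (j := 2) (by decide)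
  rw [wedge₃, wedge₃, ← h]
  congr 1
  ext i; fin_cases i <;> rfl

end

theorem schoutenDecomposable_swap_left (a₁ a₂ b₁ b₂ : L) :
    schoutenDecomposable R a₂ a₁ b₁ b₂ = -schoutenDecomposable R a₁ a₂ b₁ b₂ := by
  simp only [schoutenDecomposable]; abel

theorem schoutenDecomposable_swap_right (a₁ a₂ b₁ b₂ : L) :
    schoutenDecomposable R a₁ a₂ b₂ b₁ = -schoutenDecomposable R a₁ a₂ b₁ b₂ := by
  simp only [schoutenDecomposable]; abel

variable [LieRingModule L R] [LieRinehartRing R L]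

theorem smul_lie_eq (r : R) (x y : L) : ⁅r • x, y⁆ = r • ⁅x, y⁆ - ⁅y, r⁆ • x := by
  rw [← lie_skew, LieRinehartRing.leibniz_smul_right, neg_add, ← smul_neg, lie_skew, sub_eq_add_neg]

open TensorProduct in
/-- `schoutenDecomposable a₁ a₂` extended to tensors `b₁ ⊗ b₂`. -/
def schoutenRight (a₁ a₂ : L) : L ⊗[R] L →+ ⋀[R]^3 L :=
  TensorProduct.liftAddHom
    (AddMonoidHom.mk' (fun b₁ => AddMonoidHom.mk' (fun b₂ => schoutenDecomposable R a₁ a₂ b₁ b₂)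
      (by intros; simp only [schoutenDecomposable, lie_add, wedge₃_add₁, wedge₃_add₃]; abel))
      (by
        intros
        refine AddMonoidHom.ext fun b₂ => ?_
        simp only [schoutenDecomposable, lie_add, wedge₃_add₁, wedge₃_add₃, AddMonoidHom.mk'_apply,
          AddMonoidHom.add_apply]
        abel))
    (by
      intro r b₁ b₂
      simp only [AddMonoidHom.mk'_apply, schoutenDecomposable, LieRinehartRing.leibniz_smul_right,
        wedge₃_add₁, wedge₃_smul₁, wedge₃_smul₃]
      rw [wedge₃_swap₁₂ a₂ b₁ b₂, wedge₃_swap₁₂ a₁ b₁ b₂, wedge₃_swap₁₂ a₂ b₂ b₁,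
        wedge₃_swap₂₃ a₂ b₁ b₂, wedge₃_swap₁₂ a₁ b₂ b₁, wedge₃_swap₂₃ a₁ b₁ b₂]
      module)

theorem schoutenRight_tmul (a₁ a₂ b₁ b₂ : L) :
    schoutenRight a₁ a₂ (b₁ ⊗ₜ[R] b₂) = schoutenDecomposable R a₁ a₂ b₁ b₂ := rfl

theorem addHom_ext_tmul {f g : TensorProduct R L L →+ ⋀[R]^3 L}
    (h : ∀ b₁ b₂ : L, f (b₁ ⊗ₜ[R] b₂) = g (b₁ ⊗ₜ[R] b₂)) : f = g :=
  AddMonoidHom.ext fun t => by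
    induction t using TensorProduct.induction_on with
    | zero => rw [map_zero, map_zero]
    | add x y hx hy => rw [map_add, map_add, hx, hy]
    | tmul b₁ b₂ => exact h b₁ b₂

theorem schoutenRight_add_left (a₁ a₁' a₂ : L) :
    (schoutenRight (a₁ + a₁') a₂ : TensorProduct R L L →+ ⋀[R]^3 L) =
      schoutenRight a₁ a₂ + schoutenRight a₁' a₂ := by
  refine addHom_ext_tmul fun b₁ b₂ => ?_
  rw [AddMonoidHom.add_apply]
  simp only [schoutenRight_tmul, schoutenDecomposable, add_lie, wedge₃_add₁, wedge₃_add₂]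
  abel

theorem schoutenRight_add_right (a₁ a₂ a₂' : L) :
    (schoutenRight a₁ (a₂ + a₂') : TensorProduct R L L →+ ⋀[R]^3 L) =
      schoutenRight a₁ a₂ + schoutenRight a₁ a₂' := by
  refine addHom_ext_tmul fun b₁ b₂ => ?_
  rw [AddMonoidHom.add_apply]
  simp only [schoutenRight_tmul, schoutenDecomposable, add_lie, wedge₃_add₁, wedge₃_add₂]
  abel

theorem schoutenRight_smul (r : R) (a₁ a₂ : L) :
    (schoutenRight (r • a₁) a₂ : TensorProduct R L L →+ ⋀[R]^3 L) =
      schoutenRight a₁ (r • a₂) := by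
  refine addHom_ext_tmul fun b₁ b₂ => ?_
  simp only [schoutenRight_tmul, schoutenDecomposable, smul_lie_eq, sub_eq_add_neg, ← neg_smul,
    wedge₃_add₁, wedge₃_smul₁, wedge₃_smul₂]
  rw [wedge₃_swap₁₂ a₁ a₂ b₂, wedge₃_swap₁₂ a₁ a₂ b₁]
  module

open TensorProduct in
/-- The bracket extended to tensors `a₁ ⊗ a₂` and `b₁ ⊗ b₂`. -/
def schoutenTensor : L ⊗[R] L →+ L ⊗[R] L →+ ⋀[R]^3 L :=
  TensorProduct.liftAddHom
    (AddMonoidHom.mk'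
      (fun a₁ => AddMonoidHom.mk' (fun a₂ => schoutenRight a₁ a₂) (schoutenRight_add_right a₁))
      (fun a₁ a₁' => AddMonoidHom.ext fun a₂ => schoutenRight_add_left a₁ a₁' a₂))
    schoutenRight_smul

theorem schoutenTensor_tmul (a₁ a₂ b₁ b₂ : L) :
    schoutenTensor (a₁ ⊗ₜ[R] a₂) (b₁ ⊗ₜ[R] b₂) = schoutenDecomposable R a₁ a₂ b₁ b₂ := rfl

open TensorProduct in
/-- `X ∧ Y ↦ X ⊗ Y - Y ⊗ X`. -/
def bivectorToTensor : ⋀[R]^2 L →ₗ[R] L ⊗[R] L :=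
  liftBivector (TensorProduct.mk R L L - (TensorProduct.mk R L L).flip) (by intro x; simp)

/-- The Schouten bracket of two bivectors: the additive extension of the bracket of decomposable
bivectors, see `schouten_wedge`. -/
def schouten [Algebra ℝ R] (P Q : ⋀[R]^2 L) : ⋀[R]^3 L :=
  algebraMap ℝ R (1 / 4) • schoutenTensor (bivectorToTensor P) (bivectorToTensor Q)

theorem schouten_wedge [Algebra ℝ R] (a₁ a₂ b₁ b₂ : L) :
    schouten (exteriorPower.ιMulti R 2 ![a₁, a₂]) (exteriorPower.ιMulti R 2 ![b₁, b₂]) =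
      schoutenDecomposable R a₁ a₂ b₁ b₂ := by
  have h4 : algebraMap ℝ R (1 / 4) * 4 = 1 := by
    have : (4 : R) = algebraMap ℝ R 4 := (map_ofNat _ 4).symm
    rw [this, ← map_mul]; norm_num
  simp only [schouten, bivectorToTensor, liftBivector_wedge, LinearMap.sub_apply,
    LinearMap.flip_apply, TensorProduct.mk_apply, map_sub, AddMonoidHom.sub_apply,
    schoutenTensor_tmul]
  rw [schoutenDecomposable_swap_right a₂ a₁ b₁ b₂, schoutenDecomposable_swap_right a₁ a₂ b₁ b₂,
    schoutenDecomposable_swap_left a₁ a₂ b₁ b₂]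
  generalize schoutenDecomposable R a₁ a₂ b₁ b₂ = T
  calc _ = (algebraMap ℝ R (1 / 4) * 4) • T := by module
    _ = T := by rw [h4, one_smul]

theorem schouten_add_left [Algebra ℝ R] (P P' Q : ⋀[R]^2 L) :
    schouten (P + P') Q = schouten P Q + schouten P' Q := by
  simp [schouten]

theorem schouten_add_right [Algebra ℝ R] (P Q Q' : ⋀[R]^2 L) :
    schouten P (Q + Q') = schouten P Q + schouten P Q' := by
  simp [schouten]

/-! ### Differential, Lie derivative and the bracket of `1`-forms -/

/-- The Lie algebroid differential of a `q`-form, `q ≥ 1`, given by its values: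
`(dη)(a₀, …, a_q) = ∑ₖ (-1)^k ρ(aₖ) · η(…, âₖ, …)
  + ∑_{k < l} (-1)^(k+l) η([aₖ, a_l], …, âₖ, …, â_l, …)`.
In the double sum the pair `k ≤ l` stands for the pair of indices `k < l + 1`. -/
def differential (p : ℕ) (η : (Fin (p + 1) → L) → R) (a : Fin (p + 2) → L) : R :=
  ∑ k : Fin (p + 2), (-1) ^ (k : ℕ) * ⁅a k, η (k.removeNth a)⁆ +
    ∑ k : Fin (p + 2), ∑ l : Fin (p + 1),
      if (k : ℕ) ≤ l then
        (-1) ^ ((k : ℕ) + (l + 1)) *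
          η (Fin.cons ⁅a k, a l.succ⁆ (l.removeNth (k.removeNth a)))
      else 0

/-- The differential of a function. -/
def differentialZero (f : R) : Module.Dual R L where
  toFun X := ⁅X, f⁆
  map_add' X Y := add_lie X Y f
  map_smul' r X := by simp

/-- The differential of a `1`-form, as an alternating map. -/
def differentialOne (α : Module.Dual R L) : L [⋀^Fin 2]→ₗ[R] R :=
  alternatingOfBilin
    (LinearMap.mk₂ R (fun X Y => ⁅X, α Y⁆ - ⁅Y, α X⁆ - α ⁅X, Y⁆)
      (by intros; simp only [add_lie, lie_add, map_add]; abel)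
      (by
        intro r X Y
        simp only [smul_lie_eq, map_sub, map_smul, smul_eq_mul, LieRinehartRing.leibniz_mul_right,
          LieRinehartRing.lie_smul_eq_mul]
        ring)
      (by intros; simp only [add_lie, lie_add, map_add]; abel)
      (by
        intro r X Y
        simp only [map_add, map_smul, smul_eq_mul, LieRinehartRing.leibniz_mul_right,
          LieRinehartRing.lie_smul_eq_mul, LieRinehartRing.leibniz_smul_right]
        ring))
    (by intro X; simp)

theorem differentialOne_eq (α : Module.Dual R L) (a : Fin 2 → L) :
    differentialOne α a = differential 0 (fun v => α (v 0)) a := by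
  simp [differentialOne, alternatingOfBilin, differential, Fin.sum_univ_succ, Fin.removeNth]
  ring

/-- The Lie derivative of a `1`-form. -/
def lieOne (X : L) (α : Module.Dual R L) : Module.Dual R L where
  toFun Y := ⁅X, α Y⁆ - α ⁅X, Y⁆
  map_add' Y Z := by simp only [lie_add, map_add]; abel
  map_smul' r Y := by
    simp only [map_smul, map_add, smul_eq_mul, LieRinehartRing.leibniz_mul_right,
      LieRinehartRing.leibniz_smul_right, RingHom.id_apply]
    ring

/-- The bracket of `1`-forms
`[α, β]_{π,ψ} = 𝓛_{π♯α} β - 𝓛_{π♯β} α - d(π(α, β)) + ψ(π♯α, π♯β, ·)`. -/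
def dualBracket (π : ⋀[R]^2 L) (ψ : ⋀[R]^3 (Module.Dual R L)) (α β : Module.Dual R L) :
    Module.Dual R L :=
  lieOne (sharp π α) β - lieOne (sharp π β) α - differentialZero (β (sharp π α)) +
    insertTwo (evalForm ψ) (sharp π α) (sharp π β)

/-- `(π, ψ)` is a twisted Poisson structure: `dψ = 0` and `½ [π, π] = (∧³ π♯) ψ`. -/
def IsTwistedPoisson [Algebra ℝ R] (π : ⋀[R]^2 L) (ψ : ⋀[R]^3 (Module.Dual R L)) : Prop :=
  differential 2 (evalForm ψ) = 0 ∧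
    algebraMap ℝ R (1 / 2) • schouten π π = exteriorPower.map 3 (sharp π) ψ

/-! ### Cohomology of the dual Lie algebroid in degree one -/

/-- `d_{π,ψ}` on functions: the section with `⟨α, d f⟩ = ρ(π♯ α) · f`. -/
def dualDifferentialZero (π : ⋀[R]^2 L) (f : R) : L := -sharp π (differentialZero f)

/-- `d_{π,ψ}` on a section `Z` of the Lie algebroid, a `1`-cochain of the dual Lie algebroid with
anchor `ρ ∘ π♯` and bracket `[·, ·]_{π,ψ}`. -/
def dualDifferentialOne (π : ⋀[R]^2 L) (ψ : ⋀[R]^3 (Module.Dual R L)) (Z : L)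
    (α β : Module.Dual R L) : R :=
  ⁅sharp π α, β Z⁆ - ⁅sharp π β, α Z⁆ - dualBracket π ψ α β Z

/-- The `d_{π,ψ}`-cocycles of degree one. -/
def cocycles (π : ⋀[R]^2 L) (ψ : ⋀[R]^3 (Module.Dual R L)) : AddSubgroup L where
  carrier := {Z | ∀ α β, dualDifferentialOne π ψ Z α β = 0}
  zero_mem' := by intro α β; simp [dualDifferentialOne]
  add_mem' {Z W} hZ hW α β := by
    have h := congrArg₂ (· + ·) (hZ α β) (hW α β)
    simp only [dualDifferentialOne, map_add, lie_add, add_zero] at h ⊢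
    rw [← h]; abel
  neg_mem' {Z} hZ α β := by
    have h := congrArg Neg.neg (hZ α β)
    simp only [dualDifferentialOne, map_neg, lie_neg, neg_zero] at h ⊢
    rw [← h]; abel

/-- The `d_{π,ψ}`-coboundaries of degree one. -/
def coboundaries (π : ⋀[R]^2 L) : AddSubgroup L where
  carrier := {Z | ∃ f : R, Z = dualDifferentialZero π f}
  zero_mem' := ⟨0, by
    have : (differentialZero 0 : Module.Dual R L) = 0 := by ext; simp [differentialZero]
    simp [dualDifferentialZero, this]⟩
  add_mem' := by
    rintro _ _ ⟨f, rfl⟩ ⟨g, rfl⟩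
    have : (differentialZero (f + g) : Module.Dual R L) =
        differentialZero f + differentialZero g := by ext; simp [differentialZero]
    exact ⟨f + g, by simp only [dualDifferentialZero, this, map_add]; abel⟩
  neg_mem' := by
    rintro _ ⟨f, rfl⟩
    have : (differentialZero (-f) : Module.Dual R L) = -differentialZero f := by
      ext; simp [differentialZero]
    exact ⟨-f, by simp only [dualDifferentialZero, this, map_neg]⟩

/-- The first Lie algebroid cohomology of the dual Lie algebroid. -/
abbrev cohomologyOne (π : ⋀[R]^2 L) (ψ : ⋀[R]^3 (Module.Dual R L)) : Type _ :=
  cocycles π ψ ⧸ (coboundaries π).addSubgroupOf (cocycles π ψ)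

/-- The cohomology class of a cocycle. -/
def cohomologyClass {π : ⋀[R]^2 L} {ψ : ⋀[R]^3 (Module.Dual R L)} (Z : cocycles π ψ) :
    cohomologyOne π ψ :=
  QuotientAddGroup.mk Z

/-! ### The sections `X` and `Y` -/

/-- The section `Y_{π,ψ}`, i.e. `π♯` of the contraction of `ψ` with `π`.  The contraction is the
one for which `⟨α, Y_{π,ψ}⟩ = ½ Tr (β ↦ ψ(π♯ α, π♯ β, ·))`, see `two_mul_apply_sectionY`. -/
def sectionY (π : ⋀[R]^2 L) (ψ : ⋀[R]^3 (Module.Dual R L)) : L :=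
  sharp π (insertBivector (evalForm ψ) π)

/-- Induction on bivectors. -/
theorem bivector_induction {P : ⋀[R]^2 L → Prop} (h₀ : P 0)
    (h : ∀ X Y, P (exteriorPower.ιMulti R 2 ![X, Y])) (hadd : ∀ a b, P a → P b → P (a + b))
    (π : ⋀[R]^2 L) : P π := by
  have hπ : π ∈ Submodule.span R (Set.range (exteriorPower.ιMulti R 2 (M := L))) := by
    rw [exteriorPower.ιMulti_span]; trivial
  induction hπ using Submodule.closure_induction with
  | zero => exact h₀
  | add a b _ _ ha hb => exact hadd a b ha hb
  | smul_mem r x hx =>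
    obtain ⟨v, rfl⟩ := hx
    have : r • exteriorPower.ιMulti R 2 v = exteriorPower.ιMulti R 2 ![r • v 0, v 1] := by
      have h := (exteriorPower.ιMulti R 2).map_update_smul v 0 r (v 0)
      rw [Function.update_eq_self] at h
      rw [← h]; congr 1; ext i; fin_cases i <;> simp
    rw [this]; exact h _ _

theorem apply_sharp (π : ⋀[R]^2 L) (α β : Module.Dual R L) :
    α (sharp π β) = -β (sharp π α) := by
  induction π using bivector_induction with
  | h₀ => simp
  | h X Y => simp only [sharp_wedge, map_sub, map_smul, smul_eq_mul]; ring
  | hadd a b ha hb => simp only [map_add, LinearMap.add_apply, ha, hb]; ring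

/-- For dual bases `e`, `ε` (more generally, whenever `v = ∑ₖ εₖ(v) eₖ` for all `v`), the trace
formula `2 ⟨α, Y_{π,ψ}⟩ = ∑ₖ ψ(π♯ α, π♯ εₖ, eₖ)`. -/
theorem two_mul_apply_sectionY {ι : Type*} [Fintype ι] (e : ι → L) (ε : ι → Module.Dual R L)
    (he : ∀ v, v = ∑ k, ε k v • e k) (π : ⋀[R]^2 L) (ψ : ⋀[R]^3 (Module.Dual R L))
    (α : Module.Dual R L) :
    2 * α (sectionY π ψ) = ∑ k, evalForm ψ ![sharp π α, sharp π (ε k), e k] := by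
  rw [sectionY, apply_sharp]
  generalize sharp π α = a
  have key : ∀ X Y : L, ∑ k, ε k X * evalForm ψ ![a, Y, e k] = evalForm ψ ![a, Y, X] := by
    intro X Y
    have h := congrArg (insertTwo (evalForm ψ) a Y) (he X)
    simp only [map_sum, map_smul, smul_eq_mul] at h
    exact h.symm
  induction π using bivector_induction with
  | h₀ =>
    simp only [map_zero, LinearMap.zero_apply, neg_zero, mul_zero]
    refine (Finset.sum_eq_zero fun k _ => ?_).symm
    exact (evalForm ψ).map_coord_zero 1 rfl
  | h X Y =>
    have hterm : ∀ k, evalForm ψ ![a, ε k X • Y - ε k Y • X, e k] =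
        ε k X * evalForm ψ ![a, Y, e k] - ε k Y * evalForm ψ ![a, X, e k] := by
      intro k
      rw [sub_eq_add_neg, ← neg_smul, alternating_add₂, alternating_smul₂, alternating_smul₂]
      simp only [smul_eq_mul]; ring
    have s₁ := (evalForm ψ).map_swap ![a, X, Y] (i := 1) (j := 2) (by decide)
    have e₁ : (![a, X, Y] ∘ Equiv.swap (1 : Fin 3) 2) = ![a, Y, X] := by
      ext i; fin_cases i <;> rfl
    have s₂ := (evalForm ψ).map_swap ![a, X, Y] (i := 0) (j := 1) (by decide)
    have e₂ : (![a, X, Y] ∘ Equiv.swap (0 : Fin 3) 1) = ![X, a, Y] := by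
      ext i; fin_cases i <;> rfl
    have s₃ := (evalForm ψ).map_swap ![X, a, Y] (i := 1) (j := 2) (by decide)
    have e₃ : (![X, a, Y] ∘ Equiv.swap (1 : Fin 3) 2) = ![X, Y, a] := by
      ext i; fin_cases i <;> rfl
    rw [e₁] at s₁; rw [e₂] at s₂; rw [e₃] at s₃
    simp only [sharp_wedge, hterm, Finset.sum_sub_distrib, key, insertBivector_wedge]
    rw [s₃, s₂, s₁]; ring
  | hadd x y hx hy =>
    have hterm : ∀ k, evalForm ψ ![a, sharp (x + y) (ε k), e k] =
        evalForm ψ ![a, sharp x (ε k), e k] + evalForm ψ ![a, sharp y (ε k), e k] := by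
      intro k
      rw [map_add, LinearMap.add_apply, alternating_add₂]
    simp_rw [hterm]
    rw [Finset.sum_add_distrib, ← hx, ← hy, map_add, LinearMap.add_apply]
    ring

/-- The Lie derivative of an `n`-form along `X`, given by its values. -/
def lieForm {n : ℕ} (X : L) (vol : ⋀[R]^n (Module.Dual R L)) (s : Fin n → L) : R :=
  ⁅X, evalForm vol s⁆ - ∑ i, evalForm vol (Function.update s i ⁅X, s i⁆)

/-- `X` is the section `X_{π,λ}` of the form `λ = vol` of top degree:
`⟨α, X⟩ λ = 𝓛_{π♯ α} λ - (i_π dα) λ` for all `1`-forms `α`. -/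
def IsSectionX {n : ℕ} (π : ⋀[R]^2 L) (vol : ⋀[R]^n (Module.Dual R L)) (X : L) : Prop :=
  ∀ (α : Module.Dual R L) (s : Fin n → L),
    α X * evalForm vol s =
      lieForm (sharp π α) vol s - contractTwoForm π (differentialOne α) * evalForm vol s

end LieRinehart

/-! ### Lie algebroids over a manifold -/

section Geometry

variable (E F : Type*) [NormedAddCommGroup E] [NormedSpace ℝ E]
  [NormedAddCommGroup F] [NormedSpace ℝ F]
  {M : Type*} [TopologicalSpace M] [ChartedSpace E M] [IsManifold 𝓘(ℝ, E) ∞ M]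
  (A : M → Type*) [TopologicalSpace (Bundle.TotalSpace F A)]
  [∀ x, AddCommGroup (A x)] [∀ x, Module ℝ (A x)] [∀ x, TopologicalSpace (A x)]
  [FiberBundle F A] [VectorBundle ℝ F A]

variable (M) in
/-- `C^∞(M)`. -/
abbrev SmoothFun : Type _ := C^∞⟮𝓘(ℝ, E), M; 𝓘(ℝ, ℝ), ℝ⟯

/-- `Γ(A)`, the smooth sections of `A`. -/
abbrev Sections : Type _ := Cₛ^∞⟮𝓘(ℝ, E); F, A⟯

instance : SMul (SmoothFun E M) (Sections E F A) where
  smul f s := ⟨fun x => f x • s x, ContMDiff.smul_section f.contMDiff s.contMDiff⟩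

variable {E F A} in
theorem smul_section_apply (f : SmoothFun E M) (s : Sections E F A) (x : M) :
    (f • s) x = f x • s x := rfl

instance : Module (SmoothFun E M) (Sections E F A) where
  one_smul s := by ext x; exact one_smul ℝ (s x)
  mul_smul f g s := by ext x; exact mul_smul (f x) (g x) (s x)
  smul_zero f := by ext x; exact smul_zero (f x)
  smul_add f s t := by ext x; exact smul_add (f x) (s x) (t x)
  add_smul f g s := by ext x; exact add_smul (f x) (g x) (s x)
  zero_smul s := by ext x; exact zero_smul ℝ (s x)

/-- A smooth vector bundle morphism `A → TM` over the identity. -/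
structure Anchor where
  /-- the linear map on fibres -/
  toFun : ∀ x : M, A x →ₗ[ℝ] TangentSpace 𝓘(ℝ, E) x
  /-- smooth sections are mapped to smooth vector fields -/
  smooth' : ∀ s : Sections E F A, ContMDiff 𝓘(ℝ, E) 𝓘(ℝ, E).tangent ∞
    (fun x => (⟨x, toFun x (s x)⟩ : TangentBundle 𝓘(ℝ, E) M))

variable {E F A}

/-- The derivative of `f` at `x` in the direction `v`. -/
def dirDeriv (f : M → ℝ) (x : M) (v : TangentSpace 𝓘(ℝ, E) x) : ℝ :=
  mfderiv 𝓘(ℝ, E) 𝓘(ℝ, ℝ) f x v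

/-- `ρ(a) · f`, the derivative of `f` along the vector field `ρ(a)`. -/
def Anchor.deriv (ρ : Anchor E F A) (a : Sections E F A) (f : SmoothFun E M) : SmoothFun E M where
  val x := dirDeriv f x (ρ.toFun x (a x))
  property := by
    have h₁ : ContMDiff 𝓘(ℝ, E).tangent 𝓘(ℝ, ℝ).tangent ∞ (tangentMap 𝓘(ℝ, E) 𝓘(ℝ, ℝ) f) :=
      f.contMDiff.contMDiff_tangentMap le_rfl
    exact (contMDiff_snd_tangentBundle_modelSpace ℝ 𝓘(ℝ, ℝ)).comp (h₁.comp (ρ.smooth' a))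

theorem Anchor.deriv_apply (ρ : Anchor E F A) (a : Sections E F A) (f : SmoothFun E M) (x : M) :
    ρ.deriv a f x = dirDeriv f x (ρ.toFun x (a x)) := rfl

variable (E F A) in
/-- A Lie algebroid structure on the vector bundle `A`. -/
class LieAlgebroid where
  /-- the anchor -/
  anchor : Anchor E F A
  /-- the bracket of sections -/
  bracket : Sections E F A →ₗ[ℝ] Sections E F A →ₗ[ℝ] Sections E F A
  bracket_self : ∀ a, bracket a a = 0
  jacobi : ∀ a b c, bracket a (bracket b c) = bracket (bracket a b) c + bracket b (bracket a c)
  leibniz : ∀ (a b : Sections E F A) (f : SmoothFun E M),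
    bracket a (f • b) = f • bracket a b + anchor.deriv a f • b
  /-- the anchor maps the bracket to the commutator of vector fields -/
  anchor_bracket : ∀ (a b : Sections E F A) (f : SmoothFun E M),
    anchor.deriv (bracket a b) f =
      anchor.deriv a (anchor.deriv b f) - anchor.deriv b (anchor.deriv a f)

section Instances

variable (ρ : Anchor E F A) (a b : Sections E F A) (f g : SmoothFun E M)

theorem Anchor.deriv_add_left : ρ.deriv (a + b) f = ρ.deriv a f + ρ.deriv b f := by
  ext x
  change dirDeriv f x (ρ.toFun x (a x + b x)) = _
  rw [map_add]
  exact map_add (mfderiv 𝓘(ℝ, E) 𝓘(ℝ, ℝ) f x) _ _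

theorem Anchor.deriv_smul_left : ρ.deriv (f • a) g = f * ρ.deriv a g := by
  ext x
  change dirDeriv g x (ρ.toFun x (f x • a x)) = _
  rw [map_smul]
  exact map_smul (mfderiv 𝓘(ℝ, E) 𝓘(ℝ, ℝ) g x) _ _

theorem SmoothFun.mdifferentiableAt (x : M) :
    MDifferentiableAt 𝓘(ℝ, E) 𝓘(ℝ, ℝ) f x :=
  f.contMDiff.mdifferentiableAt (by simp)

theorem Anchor.deriv_add_right : ρ.deriv a (f + g) = ρ.deriv a f + ρ.deriv a g := by
  ext x
  have h := mfderiv_add (SmoothFun.mdifferentiableAt f x) (SmoothFun.mdifferentiableAt g x)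
  change (mfderiv 𝓘(ℝ, E) 𝓘(ℝ, ℝ) (⇑f + ⇑g) x (ρ.toFun x (a x)) : ℝ) = _
  rw [h]; rfl

theorem Anchor.deriv_mul_right : ρ.deriv a (f * g) = f * ρ.deriv a g + ρ.deriv a f * g := by
  ext x
  have h := ((SmoothFun.mdifferentiableAt f x).hasMFDerivAt.mul
    (SmoothFun.mdifferentiableAt g x).hasMFDerivAt).mfderiv
  change (mfderiv 𝓘(ℝ, E) 𝓘(ℝ, ℝ) (⇑f * ⇑g) x (ρ.toFun x (a x)) : ℝ) =
    f x * dirDeriv g x (ρ.toFun x (a x)) + dirDeriv f x (ρ.toFun x (a x)) * g x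
  rw [h, mul_comm (dirDeriv f x (ρ.toFun x (a x)))]
  rfl

variable [LieAlgebroid E F A]

instance : LieRing (Sections E F A) where
  bracket a b := LieAlgebroid.bracket a b
  add_lie a b c := by simp
  lie_add a b c := by simp
  lie_self a := LieAlgebroid.bracket_self a
  leibniz_lie a b c := LieAlgebroid.jacobi a b c

instance : LieRingModule (Sections E F A) (SmoothFun E M) where
  bracket a f := (LieAlgebroid.anchor : Anchor E F A).deriv a f
  add_lie a b f := Anchor.deriv_add_left _ a b f
  lie_add a f g := Anchor.deriv_add_right _ a f g
  leibniz_lie a b f := by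
    change Anchor.deriv _ a (Anchor.deriv _ b f) =
      Anchor.deriv _ (LieAlgebroid.bracket a b) f + Anchor.deriv _ b (Anchor.deriv _ a f)
    rw [LieAlgebroid.anchor_bracket]; abel

instance : LieRinehartRing (SmoothFun E M) (Sections E F A) where
  lie_smul_eq_mul' f g a := Anchor.deriv_smul_left _ a f g
  leibniz_mul_right' a f g := Anchor.deriv_mul_right _ a f g
  leibniz_smul_right' a b f := LieAlgebroid.leibniz a b f

end Instances

/-! ### Volume forms and densities -/

variable (E F A) in
/-- A volume form on `A`: a nowhere vanishing form of top degree. -/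
structure VolumeForm where
  form : ⋀[SmoothFun E M]^(Module.finrank ℝ F) (Module.Dual (SmoothFun E M) (Sections E F A))
  nowhere_vanishing : ∀ x : M, ∃ s : Fin (Module.finrank ℝ F) → Sections E F A,
    evalForm form s x ≠ 0

variable (E F A) in
/-- A smooth nowhere vanishing density on `A`: for every `x` a function `μ_x` of `N` vectors of
`A x`, `N` the rank, with `μ_x(T v₁, …, T v_N) = |det T| μ_x(v₁, …, v_N)`. -/
structure Density where
  toFun : ∀ x : M, (Fin (Module.finrank ℝ F) → A x) → ℝ
  map_det : ∀ (x : M) (T : A x →ₗ[ℝ] A x) (v : Fin (Module.finrank ℝ F) → A x),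
    toFun x (fun i => T (v i)) = |LinearMap.det T| * toFun x v
  /-- the value on a smooth frame is smooth -/
  smooth' : ∀ (s : Fin (Module.finrank ℝ F) → Sections E F A) (x : M),
    LinearIndependent ℝ (fun i => s i x) →
      ContMDiffAt 𝓘(ℝ, E) 𝓘(ℝ, ℝ) ∞ (fun y => toFun y (fun i => s i y)) x
  nowhere_vanishing : ∀ x : M, ∃ v, toFun x v ≠ 0

variable [LieAlgebroid E F A]

/-- The Lie derivative of a density along `X`, evaluated at `x` on sections `s₁, …, s_N` which form
a basis at `x`: `ρ(X) · μ(s₁, …, s_N) - d/dt|_{t = 0} μ(s₁ + t [X, s₁], …, s_N + t [X, s_N])`. -/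
def Density.lie (μ : Density E F A) (X : Sections E F A)
    (s : Fin (Module.finrank ℝ F) → Sections E F A) (x : M) : ℝ :=
  dirDeriv (fun y => μ.toFun y (fun i => s i y)) x
      ((LieAlgebroid.anchor : Anchor E F A).toFun x (X x)) -
    deriv (fun t : ℝ => μ.toFun x (fun i => s i x + t • (⁅X, s i⁆ : Sections E F A) x)) 0

/-- `X` is the section `X_{π,μ}` of the density `μ`:
`⟨α, X⟩ μ = 𝓛_{π♯ α} μ - (i_π dα) μ` for all `1`-forms `α`. -/
def Density.IsSectionX (π : ⋀[SmoothFun E M]^2 (Sections E F A)) (μ : Density E F A)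
    (X : Sections E F A) : Prop :=
  ∀ (α : Module.Dual (SmoothFun E M) (Sections E F A))
    (s : Fin (Module.finrank ℝ F) → Sections E F A) (x : M),
    LinearIndependent ℝ (fun i => s i x) →
      α X x * μ.toFun x (fun i => s i x) =
        μ.lie (sharp π α) s x -
          contractTwoForm π (differentialOne α) x * μ.toFun x (fun i => s i x)

end Geometry

end TwistedPoisson

end

noncomputable section

namespace TwistedPoisson

/-! ### Bivectors and forms over a Lie–Rinehart pair. -/

section Algebra

variable {R L : Type*} [CommRing R] [LieRing L] [Module R L]
  [LieRingModule L R] [LieRinehartRing R L]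

/-! A density `λ` defines a divergence `δ` on sections by `𝓛_V λ = δ(V) λ`. It satisfies `δ(fV) = f
δ(V) + ρ(V)·f` and `δ[V, W] = ρ(V)·δ(W) - ρ(W)·δ(V)` (`Density.isDivergence`). The equation for `X`
becomes `⟨α, X⟩ = δ(π♯α) - i_π dα`. If `π = ∑ aᵢ ∧ bᵢ`, it is solved by `∑ (δ(bᵢ) aᵢ - δ(aᵢ) bᵢ -
[aᵢ, bᵢ])` (`IsDivergence.exists_section`), and uniquely so because `1`-forms separate sections.
What remains of the cocycle property is algebra over a Lie–Rinehart pair.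

Put `Dα = dα - ψ(π♯α, ·, ·)`. Then `⟨α, X + Y⟩ = δ(π♯α) + ∑ (Dα)(aᵢ, bᵢ)`. Pairing the twisted
Poisson equation with `α ∧ η`, for a `2`-form `η`, gives `𝓛_{π♯α} π = (∧²π♯)(Dα)`
(`two_mul_sum_liePairing`). This is used twice. With `η = β ∧ γ` it shows that `π♯` is a bracket
morphism (`sharp_dualBracket`), so the part `α ↦ δ(π♯α)` is closed by the bracket rule for `δ`. With
`η = Dβ` it shows that `⟨𝓛_{π♯α} π, Dβ⟩` is symmetric in `α` and `β`, since `⟨(∧²π♯)θ, η⟩` is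
symmetric in `θ` and `η`. By `dψ = 0`, the differential of the remaining part is the
antisymmetrisation of this expression, hence zero (`IsDivergence.add_sectionY_mem_cocycles`).

The divergences of two densities differ by `V ↦ ρ(V)·f`, where `f` is the logarithm of the absolute
value of their ratio (`Density.exists_divergence_sub`). So the two sections `X` differ by `d_{π,ψ}
f` and the class is the same. A volume form has the same section `X` as its absolute value
(`VolumeForm.isSectionX_iff`).

The properties of `δ` are local: for the density `e^G |ε₁ ∧ … ∧ ε_N|` one has `δ(V) = ρ(V)·G - ∑
εᵢ([V, eᵢ])`. Since forms and brackets live on global sections, local frames are replaced by global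
sections cut off by bump functions. -/

theorem bivector_eq_sum (π : ⋀[R]^2 L) :
    ∃ (n : ℕ) (a b : Fin n → L), π = ∑ i, exteriorPower.ιMulti R 2 ![a i, b i] := by
  induction π using bivector_induction with
  | h₀ => exact ⟨0, Fin.elim0, Fin.elim0, by simp⟩
  | h X Y => exact ⟨1, fun _ => X, fun _ => Y, by simp⟩
  | hadd P Q hP hQ =>
    obtain ⟨m, a, b, rfl⟩ := hP
    obtain ⟨n, c, d, rfl⟩ := hQ
    exact ⟨m + n, Fin.append a c, Fin.append b d, by simp [Fin.sum_univ_add]⟩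

theorem sharp_sum {n : ℕ} (a b : Fin n → L) (α : Module.Dual R L) :
    sharp (∑ i, exteriorPower.ιMulti R 2 ![a i, b i]) α = ∑ i, (α (a i) • b i - α (b i) • a i) := by
  simp [map_sum, LinearMap.sum_apply, sharp_wedge]

theorem bilin_swap {η : L →ₗ[R] L →ₗ[R] R} (hη : ∀ x, η x x = 0) (x y : L) :
    η x y = -η y x := by
  have := hη (x + y)
  simp only [map_add, LinearMap.add_apply, hη] at this
  linear_combination this

/-- The `3`-form `α ∧ η`. -/
def wedgeOneTwo (α : Module.Dual R L) (η : L →ₗ[R] L →ₗ[R] R) (hη : ∀ x, η x x = 0) :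
    L [⋀^Fin 3]→ₗ[R] R where
  toFun v := α (v 0) * η (v 1) (v 2) - α (v 1) * η (v 0) (v 2) + α (v 2) * η (v 0) (v 1)
  map_update_add' {inst} v i x y := by
    -- The field quantifies over all decidability instances; fixing the standard one lets
    -- `Function.update` reduce.
    obtain rfl : inst = instDecidableEqFin 3 := Subsingleton.elim _ _
    fin_cases i <;> simp [Function.update] <;> ring
  map_update_smul' {inst} v i c x := by
    obtain rfl : inst = instDecidableEqFin 3 := Subsingleton.elim _ _
    fin_cases i <;> simp [Function.update] <;> ring
  map_eq_zero_of_eq' v i j h hij := by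
    have hs := bilin_swap hη
    have key : ∀ x y, α x * η x y - α x * η x y + α y * η x x = 0 ∧
        α x * η y x - α y * η x x + α x * η x y = 0 ∧
        α y * η x x - α x * η y x + α x * η y x = 0 := by
      intro x y
      rw [hη, hs y x]
      refine ⟨?_, ?_, ?_⟩ <;> ring
    fin_cases i <;> fin_cases j <;> simp only [Fin.zero_eta, Fin.mk_one, Fin.reduceFinMk, ne_eq,
      not_true_eq_false] at h hij
    · rw [h]; exact (key (v 1) (v 2)).1
    · rw [h]; exact (key (v 2) (v 1)).2.1
    · rw [h]; exact (key (v 0) (v 2)).1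
    · rw [h]; exact (key (v 2) (v 0)).2.2
    · rw [h]; exact (key (v 0) (v 1)).2.1
    · rw [h]; exact (key (v 1) (v 0)).2.2

theorem wedgeOneTwo_wedge₃ (α : Module.Dual R L) (η : L →ₗ[R] L →ₗ[R] R) (hη : ∀ x, η x x = 0)
    (u v w : L) :
    exteriorPower.alternatingMapLinearEquiv (wedgeOneTwo α η hη) (wedge₃ u v w) =
      α u * η v w - α v * η u w + α w * η u v := by
  simp [wedge₃, wedgeOneTwo]

/-- The `2`-form `α ∧ β`. -/
def wedgeOneOne (α β : Module.Dual R L) : L →ₗ[R] L →ₗ[R] R :=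
  LinearMap.mk₂ R (fun x y => α x * β y - α y * β x)
    (by intros; simp; ring) (by intros; simp; ring) (by intros; simp; ring)
    (by intros; simp; ring)

theorem wedgeOneOne_apply (α β : Module.Dual R L) (x y : L) :
    wedgeOneOne α β x y = α x * β y - α y * β x := rfl

/-- The `2`-form `η(V, ·, ·)`. -/
def insertOne (η : L [⋀^Fin 3]→ₗ[R] R) (V : L) : L →ₗ[R] L →ₗ[R] R :=
  LinearMap.mk₂ R (fun x y => η ![V, x, y])
    (fun x x' y => alternating_add₂ η V x x' y)
    (fun c x y => alternating_smul₂ η c V x y)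
    (fun x y y' => alternating_add₃ η V x y y')
    (fun c x y => alternating_smul₃ η c V x y)

theorem insertOne_apply (η : L [⋀^Fin 3]→ₗ[R] R) (V x y : L) :
    insertOne η V x y = η ![V, x, y] := rfl

theorem insertOne_self (η : L [⋀^Fin 3]→ₗ[R] R) (V x : L) : insertOne η V x x = 0 :=
  η.map_eq_zero_of_eq ![V, x, x] (i := 1) (j := 2) rfl (by decide)

theorem insertTwo_apply (η : L [⋀^Fin 3]→ₗ[R] R) (x y z : L) :
    insertTwo η x y z = η ![x, y, z] := rfl

theorem alternating_swap₁₂ (η : L [⋀^Fin 3]→ₗ[R] R) (x y z : L) :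
    η ![y, x, z] = -η ![x, y, z] := by
  rw [← η.map_swap ![x, y, z] (i := 0) (j := 1) (by decide)]
  congr 1; ext i; fin_cases i <;> rfl

theorem alternating_swap₂₃ (η : L [⋀^Fin 3]→ₗ[R] R) (x y z : L) :
    η ![x, z, y] = -η ![x, y, z] := by
  rw [← η.map_swap ![x, y, z] (i := 1) (j := 2) (by decide)]
  congr 1; ext i; fin_cases i <;> rfl

/-- The contraction of the image of the `2`-form `θ` under the bivectors `a ∧ b` and `c ∧ d` with
the `2`-form `η`. -/
def sharpPairing (a b c d : L) (θ η : L → L → R) : R :=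
  θ a c * η b d - θ a d * η b c - θ b c * η a d + θ b d * η a c

theorem sharpPairing_sum_comm {n : ℕ} (a b : Fin n → L) {θ η : L → L → R} :
    ∑ i, ∑ j, sharpPairing (a i) (b i) (a j) (b j) θ η =
      ∑ i, ∑ j, sharpPairing (a i) (b i) (a j) (b j) η θ := by
  simp only [sharpPairing]
  refine Finset.sum_congr rfl fun i _ => Finset.sum_congr rfl fun j _ => ?_
  ring

/-- The pairing of the Lie derivative of the bivector `a ∧ b` with a `2`-form. -/
def liePairing (a b V : L) (η : L → L → R) : R := η ⁅V, a⁆ b + η a ⁅V, b⁆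

/-- The image of `ξ ∧ ζ` under `∧²π♯` is `π♯ξ ∧ π♯ζ`. The factor 2 appears because the double sum
antisymmetrises in `ξ` and `ζ`; all later uses of `sharpPairing` carry the same factor. -/
theorem sharpPairing_wedge {n : ℕ} (a b : Fin n → L) (ξ ζ : Module.Dual R L)
    {η : L →ₗ[R] L →ₗ[R] R} (hη : ∀ x, η x x = 0) :
    ∑ i, ∑ j, sharpPairing (a i) (b i) (a j) (b j) (fun x y => wedgeOneOne ξ ζ x y)
        (fun x y => η x y) =
      2 * η (∑ i, (ξ (a i) • b i - ξ (b i) • a i)) (∑ i, (ζ (a i) • b i - ζ (b i) • a i)) := by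
  have h : ∀ ξ ζ : Module.Dual R L,
      η (∑ i, (ξ (a i) • b i - ξ (b i) • a i)) (∑ i, (ζ (a i) • b i - ζ (b i) • a i)) =
      ∑ i, ∑ j, (ξ (a i) * ζ (a j) * η (b i) (b j) - ξ (a i) * ζ (b j) * η (b i) (a j)
        - ξ (b i) * ζ (a j) * η (a i) (b j) + ξ (b i) * ζ (b j) * η (a i) (a j)) := by
    intro ξ ζ
    rw [map_sum η, LinearMap.sum_apply]
    refine Finset.sum_congr rfl fun i _ => ?_
    rw [map_sum]
    refine Finset.sum_congr rfl fun j _ => ?_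
    simp only [map_sub, map_smul, LinearMap.sub_apply, LinearMap.smul_apply, smul_eq_mul]
    ring
  rw [two_mul]
  -- The two copies of `η(π♯ξ, π♯ζ)` are written as a difference antisymmetric in `ξ` and `ζ`, which
  -- matches the double sum term by term.
  nth_rw 2 [bilin_swap hη]
  rw [h, h, ← sub_eq_add_neg, ← Finset.sum_sub_distrib]
  refine Finset.sum_congr rfl fun i _ => ?_
  rw [← Finset.sum_sub_distrib]
  refine Finset.sum_congr rfl fun j _ => ?_
  simp only [sharpPairing, wedgeOneOne_apply]
  ring

/-- Contracting `(∧³π♯)ψ` with `α` first gives `-(∧²π♯)(ψ(π♯α, ·, ·))`; the sign is the skewness of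
`π♯`. By linearity it suffices to take `ψ` decomposable, where both sides expand along `α` and `π♯α`
respectively. -/
theorem wedgeOneTwo_map_sharp {n : ℕ} (a b : Fin n → L) {π : ⋀[R]^2 L}
    (hπ : π = ∑ i, exteriorPower.ιMulti R 2 ![a i, b i]) (ψ : ⋀[R]^3 (Module.Dual R L))
    (α : Module.Dual R L) (η : L →ₗ[R] L →ₗ[R] R) (hη : ∀ x, η x x = 0) :
    2 * exteriorPower.alternatingMapLinearEquiv (wedgeOneTwo α η hη)
        (exteriorPower.map 3 (sharp π) ψ) =
      -∑ i, ∑ j, sharpPairing (a i) (b i) (a j) (b j)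
        (fun x y => insertOne (evalForm ψ) (sharp π α) x y) (fun x y => η x y) := by
  have hψ : ψ ∈ Submodule.span R (Set.range (exteriorPower.ιMulti R 3 (M := Module.Dual R L))) := by
    rw [exteriorPower.ιMulti_span]; trivial
  induction hψ using Submodule.span_induction with
  | mem x hx =>
    obtain ⟨ξ, rfl⟩ := hx
    have hξ : ∀ x y z : L, evalForm (exteriorPower.ιMulti R 3 ξ) ![x, y, z] =
        ξ 0 x * wedgeOneOne (ξ 1) (ξ 2) y z - ξ 1 x * wedgeOneOne (ξ 0) (ξ 2) y z
          + ξ 2 x * wedgeOneOne (ξ 0) (ξ 1) y z := by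
      intro x y z
      simp [evalForm, Matrix.det_fin_three, wedgeOneOne_apply]
      ring
    have h3 : exteriorPower.map 3 (sharp π) (exteriorPower.ιMulti R 3 ξ) =
        wedge₃ (sharp π (ξ 0)) (sharp π (ξ 1)) (sharp π (ξ 2)) := by
      rw [exteriorPower.map_apply_ιMulti, wedge₃]
      congr 1; ext i; fin_cases i <;> rfl
    have key : ∑ i, ∑ j, sharpPairing (a i) (b i) (a j) (b j)
        (fun x y => insertOne (evalForm (exteriorPower.ιMulti R 3 ξ)) (sharp π α) x y)
          (fun x y => η x y) =
        ξ 0 (sharp π α) * ∑ i, ∑ j, sharpPairing (a i) (b i) (a j) (b j)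
          (fun x y => wedgeOneOne (ξ 1) (ξ 2) x y) (fun x y => η x y) -
        ξ 1 (sharp π α) * ∑ i, ∑ j, sharpPairing (a i) (b i) (a j) (b j)
          (fun x y => wedgeOneOne (ξ 0) (ξ 2) x y) (fun x y => η x y) +
        ξ 2 (sharp π α) * ∑ i, ∑ j, sharpPairing (a i) (b i) (a j) (b j)
          (fun x y => wedgeOneOne (ξ 0) (ξ 1) x y) (fun x y => η x y) := by
      simp only [Finset.mul_sum, ← Finset.sum_sub_distrib, ← Finset.sum_add_distrib]
      refine Finset.sum_congr rfl fun i _ => Finset.sum_congr rfl fun j _ => ?_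
      simp only [sharpPairing, insertOne_apply, hξ]
      ring
    rw [key, sharpPairing_wedge a b _ _ hη, sharpPairing_wedge a b _ _ hη,
      sharpPairing_wedge a b _ _ hη, h3, wedgeOneTwo_wedge₃]
    simp only [← sharp_sum, ← hπ, apply_sharp π α]
    ring
  | zero =>
    simp [evalForm, sharpPairing, insertOne_apply]
  | add x y _ _ hx hy =>
    simp only [map_add, mul_add, hx, hy, ← neg_add, ← Finset.sum_add_distrib]
    congr 1
    refine Finset.sum_congr rfl fun i _ => Finset.sum_congr rfl fun j _ => ?_
    have : ∀ v : Fin 3 → L, evalForm (x + y) v = evalForm x v + evalForm y v := by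
      intro v; simp [evalForm]
    simp only [sharpPairing, insertOne_apply, this]
    ring
  | smul r x _ hx =>
    simp only [map_smul, smul_eq_mul]
    rw [mul_left_comm, hx, mul_neg, Finset.mul_sum]
    congr 1
    refine Finset.sum_congr rfl fun i _ => ?_
    rw [Finset.mul_sum]
    refine Finset.sum_congr rfl fun j _ => ?_
    have : ∀ v : Fin 3 → L, evalForm (r • x) v = r * evalForm x v := by
      intro v; simp [evalForm]
    simp only [sharpPairing, insertOne_apply, this]
    ring

/-! ### The twisted Poisson equation paired with forms, and `π♯` as a bracket morphism. -/

/-- The differential of a `1`-form, as a bilinear map. -/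
def differentialBilin (α : Module.Dual R L) : L →ₗ[R] L →ₗ[R] R :=
  LinearMap.mk₂ R (fun X Y => differentialOne α ![X, Y])
    (fun X X' Y => by
      simp only [differentialOne, alternatingOfBilin, AlternatingMap.coe_mk, MultilinearMap.coe_mk,
        Matrix.cons_val_zero, Matrix.cons_val_one, map_add, LinearMap.add_apply])
    (fun c X Y => by
      simp only [differentialOne, alternatingOfBilin, AlternatingMap.coe_mk, MultilinearMap.coe_mk,
        Matrix.cons_val_zero, Matrix.cons_val_one, map_smul, LinearMap.smul_apply])
    (fun X Y Y' => by
      simp only [differentialOne, alternatingOfBilin, AlternatingMap.coe_mk, MultilinearMap.coe_mk,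
        Matrix.cons_val_zero, Matrix.cons_val_one, map_add])
    (fun c X Y => by
      simp only [differentialOne, alternatingOfBilin, AlternatingMap.coe_mk, MultilinearMap.coe_mk,
        Matrix.cons_val_zero, Matrix.cons_val_one, map_smul])

theorem differentialBilin_apply (α : Module.Dual R L) (X Y : L) :
    differentialBilin α X Y = ⁅X, α Y⁆ - ⁅Y, α X⁆ - α ⁅X, Y⁆ := rfl

theorem differentialBilin_self (α : Module.Dual R L) (X : L) : differentialBilin α X X = 0 := by
  simp [differentialBilin_apply]

theorem contractTwoForm_differentialOne_wedge (α : Module.Dual R L) (X Y : L) :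
    contractTwoForm (exteriorPower.ιMulti R 2 ![X, Y]) (differentialOne α) =
      -differentialBilin α X Y := by
  rw [contractTwoForm, exteriorPower.alternatingMapLinearEquiv_apply_ιMulti]; rfl

theorem contractTwoForm_add (P Q : ⋀[R]^2 L) (η : L [⋀^Fin 2]→ₗ[R] R) :
    contractTwoForm (P + Q) η = contractTwoForm P η + contractTwoForm Q η := by
  simp [contractTwoForm]; ring

theorem contractTwoForm_differentialOne_sum {n : ℕ} (a b : Fin n → L) (α : Module.Dual R L) :
    contractTwoForm (∑ i, exteriorPower.ιMulti R 2 ![a i, b i]) (differentialOne α) =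
      -∑ i, differentialBilin α (a i) (b i) := by
  simp only [← Finset.sum_neg_distrib, ← contractTwoForm_differentialOne_wedge]
  simp [contractTwoForm]

/-- This is the identity `i_α [π, π] = 2 (𝓛_{π♯α} π - (∧²π♯) dα)`, paired with `η`. The term `dα`
collects the derivatives of the coefficients `α(aᵢ)`, `α(bᵢ)` of `π♯α`. -/
theorem wedgeOneTwo_schouten [Algebra ℝ R] {n : ℕ} (a b : Fin n → L) {π : ⋀[R]^2 L}
    (hπ : π = ∑ i, exteriorPower.ιMulti R 2 ![a i, b i])
    (α : Module.Dual R L) (η : L →ₗ[R] L →ₗ[R] R) (hη : ∀ x, η x x = 0) :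
    exteriorPower.alternatingMapLinearEquiv (wedgeOneTwo α η hη) (schouten π π) =
      2 * ∑ i, liePairing (a i) (b i) (sharp π α) (fun x y => η x y) -
      ∑ i, ∑ j, sharpPairing (a i) (b i) (a j) (b j)
        (fun x y => differentialBilin α x y) (fun x y => η x y) := by
  have hl : ∀ (ι : Type) (s : Finset ι) (f : ι → ⋀[R]^2 L) (Q : ⋀[R]^2 L),
      schouten (∑ i ∈ s, f i) Q = ∑ i ∈ s, schouten (f i) Q := fun ι s f Q =>
    map_sum (AddMonoidHom.mk' (fun P => schouten P Q) (fun P P' => schouten_add_left P P' Q)) f s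
  have hr : ∀ (ι : Type) (s : Finset ι) (f : ι → ⋀[R]^2 L) (Q : ⋀[R]^2 L),
      schouten Q (∑ i ∈ s, f i) = ∑ i ∈ s, schouten Q (f i) := fun ι s f Q =>
    map_sum (AddMonoidHom.mk' (fun P => schouten Q P) (fun P P' => schouten_add_right Q P P')) f s
  have hV : ∀ j, liePairing (a j) (b j) (sharp π α) (fun x y => η x y) =
      ∑ i, liePairing (a j) (b j) (α (a i) • b i - α (b i) • a i) (fun x y => η x y) := by
    intro j
    rw [hπ, sharp_sum]
    let f : L →+ R := AddMonoidHom.mk' (fun V => liePairing (a j) (b j) V (fun x y => η x y))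
      (by intro V W; simp only [liePairing, add_lie, map_add, LinearMap.add_apply]; ring)
    exact map_sum f _ _
  -- Symmetrising in `i` and `j` makes the identity hold separately for each pair of decomposable
  -- summands.
  have h2 : 2 * ∑ i, liePairing (a i) (b i) (sharp π α) (fun x y => η x y) =
      ∑ i, ∑ j, (liePairing (a j) (b j) (α (a i) • b i - α (b i) • a i) (fun x y => η x y) +
        liePairing (a i) (b i) (α (a j) • b j - α (b j) • a j) (fun x y => η x y)) := by
    simp only [Finset.sum_add_distrib, ← hV]
    rw [Finset.sum_comm]
    simp only [← hV]
    ring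
  rw [h2]
  nth_rw 1 2 [hπ]
  simp only [hl, hr, map_sum, ← Finset.sum_sub_distrib, schouten_wedge]
  refine Finset.sum_congr rfl fun i _ => Finset.sum_congr rfl fun j _ => ?_
  simp only [schoutenDecomposable, map_add, map_sub, wedgeOneTwo_wedge₃, liePairing, sharpPairing,
    differentialBilin_apply, sub_lie, smul_lie_eq, LinearMap.sub_apply, map_smul,
    LinearMap.smul_apply, smul_eq_mul]
  rw [← lie_skew (b i) (a j), ← lie_skew (b i) (b j), ← lie_skew (a i) (a j),
    ← lie_skew (a i) (b j)]
  simp only [map_neg, LinearMap.neg_apply]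
  rw [bilin_swap hη (b j) (b i), bilin_swap hη (a j) (b i), bilin_swap hη (a j) (a i),
    bilin_swap hη (a j) ⁅b j, b i⁆, bilin_swap hη (a j) ⁅b j, a i⁆,
    bilin_swap hη (a i) ⁅b j, b i⁆, bilin_swap hη (a i) ⁅a j, b i⁆]
  ring

theorem two_mul_cancel [Algebra ℝ R] {x y : R} (h : 2 * x = 2 * y) : x = y := by
  have h2 : algebraMap ℝ R (1 / 2) * 2 = 1 := by
    have : (2 : R) = algebraMap ℝ R 2 := (map_ofNat _ 2).symm
    rw [this, ← map_mul]; norm_num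
  calc x = algebraMap ℝ R (1 / 2) * 2 * x := by rw [h2, one_mul]
    _ = y := by rw [mul_assoc, h, ← mul_assoc, h2, one_mul]

/-- `dα - ψ(π♯ α, ·, ·)`. -/
def twistedDifferential (π : ⋀[R]^2 L) (ψ : ⋀[R]^3 (Module.Dual R L)) (α : Module.Dual R L) :
    L →ₗ[R] L →ₗ[R] R :=
  differentialBilin α - insertOne (evalForm ψ) (sharp π α)

theorem twistedDifferential_apply (π : ⋀[R]^2 L) (ψ : ⋀[R]^3 (Module.Dual R L))
    (α : Module.Dual R L) (x y : L) :
    twistedDifferential π ψ α x y = differentialBilin α x y - evalForm ψ ![sharp π α, x, y] := rfl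

theorem twistedDifferential_self (π : ⋀[R]^2 L) (ψ : ⋀[R]^3 (Module.Dual R L))
    (α : Module.Dual R L) (x : L) : twistedDifferential π ψ α x x = 0 := by
  rw [twistedDifferential, LinearMap.sub_apply, LinearMap.sub_apply, differentialBilin_self,
    insertOne_self, sub_zero]

/-- For a twisted Poisson structure, `𝓛_{π♯ α} π` is the image under `π♯` of
`dα - ψ(π♯ α, ·, ·)`. -/
theorem two_mul_sum_liePairing [Algebra ℝ R] {n : ℕ} (a b : Fin n → L) {π : ⋀[R]^2 L}
    (hπ : π = ∑ i, exteriorPower.ιMulti R 2 ![a i, b i]) {ψ : ⋀[R]^3 (Module.Dual R L)}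
    (h : IsTwistedPoisson π ψ) (α : Module.Dual R L) (η : L →ₗ[R] L →ₗ[R] R)
    (hη : ∀ x, η x x = 0) :
    2 * ∑ i, liePairing (a i) (b i) (sharp π α) (fun x y => η x y) =
      ∑ i, ∑ j, sharpPairing (a i) (b i) (a j) (b j)
        (fun x y => twistedDifferential π ψ α x y) (fun x y => η x y) := by
  have h₁ := wedgeOneTwo_schouten a b hπ α η hη
  have h₂ := wedgeOneTwo_map_sharp a b hπ ψ α η hη
  rw [← h.2, map_smul, smul_eq_mul, ← mul_assoc] at h₂
  have h3 : 2 * algebraMap ℝ R (1 / 2) = 1 := by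
    have : (2 : R) = algebraMap ℝ R 2 := (map_ofNat _ 2).symm
    rw [this, ← map_mul]; norm_num
  rw [h3, one_mul, h₁, sub_eq_iff_eq_add, neg_add_eq_sub, ← Finset.sum_sub_distrib] at h₂
  rw [h₂]
  refine Finset.sum_congr rfl fun i _ => ?_
  rw [← Finset.sum_sub_distrib]
  refine Finset.sum_congr rfl fun j _ => ?_
  simp only [sharpPairing, twistedDifferential_apply, insertOne_apply]
  ring

theorem lieOne_apply (V Y : L) (α : Module.Dual R L) : lieOne V α Y = ⁅V, α Y⁆ - α ⁅V, Y⁆ := rfl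

theorem differentialZero_apply (f : R) (V : L) :
    (differentialZero f : Module.Dual R L) V = ⁅V, f⁆ := rfl

theorem dualBracket_apply (π : ⋀[R]^2 L) (ψ : ⋀[R]^3 (Module.Dual R L)) (α β : Module.Dual R L)
    (V : L) :
    dualBracket π ψ α β V = lieOne (sharp π α) β V - lieOne (sharp π β) α V -
      ⁅V, β (sharp π α)⁆ + evalForm ψ ![sharp π α, sharp π β, V] := rfl

/-- `π♯` is compatible with the brackets. -/
theorem sharp_dualBracket [Algebra ℝ R] (hsep : ∀ v : L, (∀ γ : Module.Dual R L, γ v = 0) → v = 0)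
    {π : ⋀[R]^2 L} {ψ : ⋀[R]^3 (Module.Dual R L)} (h : IsTwistedPoisson π ψ)
    (α β : Module.Dual R L) :
    sharp π (dualBracket π ψ α β) = ⁅sharp π α, sharp π β⁆ := by
  obtain ⟨n, a, b, hπ⟩ := bivector_eq_sum π
  rw [← sub_eq_zero]
  refine hsep _ fun γ => ?_
  -- By the symmetry of the pairing, testing `(∧²π♯)(Dα)` on `β ∧ γ` evaluates `Dα` on `(π♯β, π♯γ)`.
  have h₁ := two_mul_sum_liePairing a b hπ h α (wedgeOneOne β γ)
    (fun x => by rw [wedgeOneOne_apply]; ring)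
  rw [sharpPairing_sum_comm, sharpPairing_wedge a b _ _ (twistedDifferential_self π ψ α),
    ← sharp_sum, ← sharp_sum, ← hπ] at h₁
  have h₂ := two_mul_cancel h₁
  -- The Leibniz rule for `𝓛_V` applied to `π♯β`, with `V = π♯α`.
  have h₃ : ∑ i, liePairing (a i) (b i) (sharp π α) (fun x y => wedgeOneOne β γ x y) =
      γ ⁅sharp π α, sharp π β⁆ - γ (sharp π (lieOne (sharp π α) β)) := by
    generalize sharp π α = V
    have : γ ⁅V, sharp π β⁆ = ⁅V, γ (sharp π β)⁆ - lieOne V γ (sharp π β) := by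
      rw [lieOne_apply]; ring
    rw [this, hπ, sharp_sum, sharp_sum]
    have hV : ∀ f : Fin n → R, ⁅V, ∑ i, f i⁆ = ∑ i, ⁅V, f i⁆ := fun f =>
      map_sum (AddMonoidHom.mk' (fun r : R => ⁅V, r⁆) (fun r s => lie_add V r s)) f _
    simp only [map_sum, hV, ← Finset.sum_sub_distrib]
    refine Finset.sum_congr rfl fun i _ => ?_
    simp only [liePairing, wedgeOneOne_apply, map_sub, map_smul, smul_eq_mul, lieOne_apply,
      lie_sub, LieRinehartRing.leibniz_mul_right]
    ring
  rw [h₃, twistedDifferential_apply, differentialBilin_apply] at h₂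
  rw [map_sub, apply_sharp, dualBracket_apply]
  rw [apply_sharp] at h₂
  rw [apply_sharp π β α, lie_neg]
  simp only [lieOne_apply] at h₂ ⊢
  linear_combination -h₂

/-- `𝓛_V` commutes with `d`, by the Jacobi identity and the compatibility of the anchor with
brackets. -/
theorem differentialBilin_lieOne (V a b : L) (β : Module.Dual R L) :
    differentialBilin (lieOne V β) a b =
      ⁅V, differentialBilin β a b⁆ - liePairing a b V (fun x y => differentialBilin β x y) := by
  simp only [differentialBilin_apply, lieOne_apply, liePairing, lie_sub, lie_lie, map_sub]
  ring

theorem differentialBilin_differentialZero (f : R) (a b : L) :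
    differentialBilin (differentialZero f) a b = 0 := by
  simp [differentialBilin_apply, differentialZero_apply]

theorem insertBivector_sum {n : ℕ} (a b : Fin n → L) (η : L [⋀^Fin 3]→ₗ[R] R) (V : L) :
    insertBivector η (∑ i, exteriorPower.ιMulti R 2 ![a i, b i]) V = ∑ i, η ![a i, b i, V] := by
  simp [map_sum, LinearMap.sum_apply, insertBivector_wedge]

theorem differential_two (η : (Fin 3 → L) → R) (a b c d : L) :
    differential 2 η ![a, b, c, d] =
      ⁅a, η ![b, c, d]⁆ - ⁅b, η ![a, c, d]⁆ + ⁅c, η ![a, b, d]⁆ - ⁅d, η ![a, b, c]⁆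
      - η ![⁅a, b⁆, c, d] + η ![⁅a, c⁆, b, d] - η ![⁅a, d⁆, b, c]
      - η ![⁅b, c⁆, a, d] + η ![⁅b, d⁆, a, c] - η ![⁅c, d⁆, a, b] := by
  have e₀ : (0 : Fin 4).removeNth ![a, b, c, d] = ![b, c, d] := by ext i; fin_cases i <;> rfl
  have e₁ : (1 : Fin 4).removeNth ![a, b, c, d] = ![a, c, d] := by ext i; fin_cases i <;> rfl
  have e₂ : (2 : Fin 4).removeNth ![a, b, c, d] = ![a, b, d] := by ext i; fin_cases i <;> rfl
  have e₃ : (3 : Fin 4).removeNth ![a, b, c, d] = ![a, b, c] := by ext i; fin_cases i <;> rfl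
  have f₀ : ∀ x y z : L, (0 : Fin 3).removeNth ![x, y, z] = ![y, z] := by
    intros; ext i; fin_cases i <;> rfl
  have f₁ : ∀ x y z : L, (1 : Fin 3).removeNth ![x, y, z] = ![x, z] := by
    intros; ext i; fin_cases i <;> rfl
  have f₂ : ∀ x y z : L, (2 : Fin 3).removeNth ![x, y, z] = ![x, y] := by
    intros; ext i; fin_cases i <;> rfl
  have hc : ∀ x y z : L, (Fin.cons x ![y, z] : Fin 3 → L) = ![x, y, z] := fun _ _ _ => rfl
  change ∑ k : Fin 4, (-1) ^ (k : ℕ) *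
      ⁅(![a, b, c, d] : Fin 4 → L) k, η (k.removeNth ![a, b, c, d])⁆ +
    ∑ k : Fin 4, ∑ l : Fin 3, (if (k : ℕ) ≤ l then (-1) ^ ((k : ℕ) + (l + 1)) *
      η (Fin.cons ⁅(![a, b, c, d] : Fin 4 → L) k, (![a, b, c, d] : Fin 4 → L) l.succ⁆
        (l.removeNth (k.removeNth ![a, b, c, d]))) else 0) = _
  simp only [Fin.sum_univ_four, Fin.sum_univ_three, e₀, e₁, e₂, e₃, f₀, f₁, f₂, hc]
  simp
  ring

theorem alternating_rotate (η : L [⋀^Fin 3]→ₗ[R] R) (x y z : L) : η ![x, y, z] = η ![y, z, x] := by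
  rw [alternating_swap₂₃ η y x z, alternating_swap₁₂ η x y z, neg_neg]

/-! ### Divergence operators, existence of `X` and the cocycle property. -/

/-- A divergence operator: a flat right connection on the ring of functions. -/
structure IsDivergence (δ : L → R) : Prop where
  apply_add : ∀ V W, δ (V + W) = δ V + δ W
  apply_smul : ∀ (f : R) V, δ (f • V) = f * δ V + ⁅V, f⁆
  apply_lie : ∀ V W, δ ⁅V, W⁆ = ⁅V, δ W⁆ - ⁅W, δ V⁆

theorem IsDivergence.exists_section {δ : L → R} (hδ : IsDivergence δ) (π : ⋀[R]^2 L) :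
    ∃ X : L, ∀ α : Module.Dual R L,
      α X = δ (sharp π α) - contractTwoForm π (differentialOne α) := by
  have h0 : δ 0 = 0 := by
    have := hδ.apply_add 0 0
    rw [add_zero] at this
    linear_combination -this
  have hneg : ∀ V, δ (-V) = - δ V := fun V => by
    have := hδ.apply_add V (-V)
    rw [add_neg_cancel, h0] at this
    linear_combination -this
  induction π using bivector_induction with
  | h₀ => exact ⟨0, fun α => by simp [h0, contractTwoForm]⟩
  | h a b =>
    refine ⟨δ b • a - δ a • b - ⁅a, b⁆, fun α => ?_⟩
    rw [sharp_wedge, contractTwoForm_differentialOne_wedge, sub_eq_add_neg (α a • b), hδ.apply_add,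
      hneg, hδ.apply_smul, hδ.apply_smul, differentialBilin_apply]
    simp only [map_sub, map_smul, smul_eq_mul]
    ring
  | hadd P Q hP hQ =>
    obtain ⟨X, hX⟩ := hP
    obtain ⟨Y, hY⟩ := hQ
    refine ⟨X + Y, fun α => ?_⟩
    rw [map_add, hX, hY, map_add, LinearMap.add_apply, hδ.apply_add, contractTwoForm_add]
    ring

theorem IsDivergence.add_sectionY_mem_cocycles [Algebra ℝ R]
    (hsep : ∀ v : L, (∀ γ : Module.Dual R L, γ v = 0) → v = 0)
    {π : ⋀[R]^2 L} {ψ : ⋀[R]^3 (Module.Dual R L)} (h : IsTwistedPoisson π ψ)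
    {δ : L → R} (hδ : IsDivergence δ) {X : L}
    (hX : ∀ α : Module.Dual R L, α X = δ (sharp π α) - contractTwoForm π (differentialOne α)) :
    X + sectionY π ψ ∈ cocycles π ψ := by
  intro α β
  obtain ⟨n, a, b, hπ⟩ := bivector_eq_sum π
  have hX' : ∀ α : Module.Dual R L,
      α X = δ (sharp π α) + ∑ i, differentialBilin α (a i) (b i) := by
    intro α
    rw [hX, ← sub_neg_eq_add, ← contractTwoForm_differentialOne_sum, ← hπ]
  have hY : ∀ α : Module.Dual R L,
      α (sectionY π ψ) = -∑ i, evalForm ψ ![a i, b i, sharp π α] := by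
    intro α
    rw [sectionY, apply_sharp, ← insertBivector_sum, ← hπ]
  -- The symmetry `⟨𝓛_{π♯α} π, Dβ⟩ = ⟨𝓛_{π♯β} π, Dα⟩`: both are the pairing of `Dα` with `Dβ`
  -- through `∧²π♯`.
  have hP : ∑ i, liePairing (a i) (b i) (sharp π α) (fun x y => twistedDifferential π ψ β x y) =
      ∑ i, liePairing (a i) (b i) (sharp π β) (fun x y => twistedDifferential π ψ α x y) := by
    apply two_mul_cancel
    rw [two_mul_sum_liePairing a b hπ h _ _ (twistedDifferential_self π ψ β),
      two_mul_sum_liePairing a b hπ h _ _ (twistedDifferential_self π ψ α), sharpPairing_sum_comm]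
  have hS : ∀ (V : L) (f : Fin n → R), ⁅V, ∑ i, f i⁆ = ∑ i, ⁅V, f i⁆ := fun V f =>
    map_sum (AddMonoidHom.mk' (fun r : R => ⁅V, r⁆) (fun r s => lie_add V r s)) f _
  rw [dualDifferentialOne]
  simp only [map_add, hX', hY, sharp_dualBracket hsep h, hδ.apply_lie, lie_add, lie_neg, hS]
  rw [← sub_eq_zero, ← Finset.sum_sub_distrib] at hP
  -- The terms with `δ` have cancelled, by `π♯[α, β] = [π♯α, π♯β]` and `hδ.apply_lie`.
  suffices hs : ∑ i, (⁅sharp π α, differentialBilin β (a i) (b i)⁆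
      - ⁅sharp π β, differentialBilin α (a i) (b i)⁆
      - differentialBilin (dualBracket π ψ α β) (a i) (b i)
      - ⁅sharp π α, evalForm ψ ![a i, b i, sharp π β]⁆
      + ⁅sharp π β, evalForm ψ ![a i, b i, sharp π α]⁆
      + evalForm ψ ![a i, b i, ⁅sharp π α, sharp π β⁆]) = 0 by
    simp only [Finset.sum_sub_distrib, Finset.sum_add_distrib] at hs
    linear_combination hs
  rw [← hP]
  refine Finset.sum_congr rfl fun i _ => ?_
  -- Closedness of `ψ` on these four sections is exactly the discrepancy between the `i`-th summand
  -- of the goal and that of `hP`.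
  have hd := congrFun h.1 ![a i, b i, sharp π α, sharp π β]
  rw [differential_two] at hd
  have hB : differentialBilin (dualBracket π ψ α β) (a i) (b i) =
      differentialBilin (lieOne (sharp π α) β) (a i) (b i) -
      differentialBilin (lieOne (sharp π β) α) (a i) (b i) -
      differentialBilin (differentialZero (β (sharp π α))) (a i) (b i) +
      differentialBilin (insertTwo (evalForm ψ) (sharp π α) (sharp π β)) (a i) (b i) := by
    simp only [dualBracket, differentialBilin_apply, LinearMap.add_apply, LinearMap.sub_apply,
      lie_add, lie_sub]
    ring
  rw [hB, differentialBilin_lieOne, differentialBilin_lieOne, differentialBilin_differentialZero,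
    differentialBilin_apply (insertTwo _ _ _)]
  simp only [liePairing, twistedDifferential_apply, insertTwo_apply]
  rw [alternating_rotate _ (b i), alternating_rotate _ (a i) (sharp π α),
    alternating_rotate _ ⁅a i, b i⁆, alternating_rotate _ ⁅sharp π α, sharp π β⁆,
    ← alternating_rotate _ (sharp π β) ⁅a i, sharp π α⁆ (b i),
    ← alternating_rotate _ (sharp π α) ⁅a i, sharp π β⁆ (b i),
    ← alternating_rotate _ (sharp π β) ⁅b i, sharp π α⁆ (a i),
    ← alternating_rotate _ (sharp π α) ⁅b i, sharp π β⁆ (a i),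
    alternating_swap₂₃ _ _ (a i) ⁅b i, sharp π α⁆, alternating_swap₂₃ _ _ (a i) ⁅b i, sharp π β⁆,
    ← lie_skew (a i) (sharp π α), ← lie_skew (a i) (sharp π β),
    ← lie_skew (b i) (sharp π α), ← lie_skew (b i) (sharp π β)] at hd
  have hn : ∀ x y z : L, evalForm ψ ![x, -y, z] = -evalForm ψ ![x, y, z] := fun x y z =>
    map_neg ((insertOne (evalForm ψ) x).flip z) y
  have hn' : ∀ x y z : L, evalForm ψ ![x, y, -z] = -evalForm ψ ![x, y, z] := fun x y z =>
    map_neg (insertOne (evalForm ψ) x y) z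
  simp only [hn, hn', Pi.zero_apply] at hd
  linear_combination -hd

/-! ### The Lie derivative of an alternating form. -/

/-- Isolates the `j`-th slot of the sum in the Lie derivative, so that its linearity in that slot
can be read off. -/
theorem sum_update_update_lie {n : ℕ} (V : L) (Ω : L [⋀^Fin n]→ₗ[R] R) (s : Fin n → L)
    (j : Fin n) (z : L) :
    ∑ i, Ω (Function.update (Function.update s j z) i ⁅V, Function.update s j z i⁆) =
      Ω (Function.update s j ⁅V, z⁆) +
        ∑ i ∈ Finset.univ.erase j, Ω (Function.update (Function.update s i ⁅V, s i⁆) j z) := by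
  rw [← Finset.add_sum_erase _ _ (Finset.mem_univ j)]
  congr 1
  · simp
  · refine Finset.sum_congr rfl fun i hi => ?_
    rw [Finset.mem_erase] at hi
    rw [Function.update_of_ne hi.1, Function.update_comm hi.1.symm]

/-- The Lie derivative of an alternating form, see `lieForm`. -/
def lieAlternating {n : ℕ} (V : L) (Ω : L [⋀^Fin n]→ₗ[R] R) : L [⋀^Fin n]→ₗ[R] R where
  toFun s := ⁅V, Ω s⁆ - ∑ i, Ω (Function.update s i ⁅V, s i⁆)
  map_update_add' {inst} s j x y := by
    obtain rfl : inst = instDecidableEqFin n := Subsingleton.elim _ _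
    have h := sum_update_update_lie V Ω s j
    simp only [h, AlternatingMap.map_update_add, lie_add, Finset.sum_add_distrib]
    ring
  map_update_smul' {inst} s j c x := by
    obtain rfl : inst = instDecidableEqFin n := Subsingleton.elim _ _
    have h := sum_update_update_lie V Ω s j
    simp only [h, AlternatingMap.map_update_smul, AlternatingMap.map_update_add,
      LieRinehartRing.leibniz_smul_right, LieRinehartRing.leibniz_mul_right, smul_eq_mul,
      ← Finset.mul_sum]
    ring
  map_eq_zero_of_eq' s i j h hij := by
    rw [Ω.map_eq_zero_of_eq s h hij, lie_zero, zero_sub, neg_eq_zero,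
      ← Finset.add_sum_erase _ _ (Finset.mem_univ i),
      ← Finset.add_sum_erase _ _ (Finset.mem_erase.2 ⟨hij.symm, Finset.mem_univ j⟩),
      Finset.sum_eq_zero, add_zero]
    -- The terms `i` and `j` are exchanged by a transposition and cancel; every other term still has
    -- two equal arguments.
    · have h₁ : Function.update s i ⁅V, s i⁆ =
          Function.update s j ⁅V, s j⁆ ∘ Equiv.swap i j := by
        ext k
        by_cases hki : k = i
        · subst hki; simp [h]
        by_cases hkj : k = j
        · subst hkj; simp [hij, hij.symm, h]
        · simp [Equiv.swap_apply_of_ne_of_ne hki hkj, hki, hkj]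
      rw [h₁, Ω.map_swap _ hij]
      ring
    · intro k hk
      simp only [Finset.mem_erase] at hk
      refine Ω.map_eq_zero_of_eq _ (i := i) (j := j) ?_ hij
      rw [Function.update_of_ne hk.2.1.symm, Function.update_of_ne hk.1.symm, h]

theorem lieAlternating_apply {n : ℕ} (V : L) (Ω : L [⋀^Fin n]→ₗ[R] R) (s : Fin n → L) :
    lieAlternating V Ω s = ⁅V, Ω s⁆ - ∑ i, Ω (Function.update s i ⁅V, s i⁆) := rfl

end Algebra

/-! ### Forms of top degree in a frame that is valid up to a factor `χ`. -/

section Frame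

variable {R L : Type*} [CommRing R] [AddCommGroup L] [Module R L]
  {n : ℕ} {e : Fin n → L} {ε : Fin n → Module.Dual R L} {χ : R}

/-- Pull `Ω` back along `R^n → L` given by `e`: on a free module a top form is a multiple of the
determinant. Each argument contributes one factor `χ`. -/
theorem smul_alternating_eq_det (h : ∀ v, ∑ i, ε i v • e i = χ • v)
    (Ω : L [⋀^Fin n]→ₗ[R] R) (s : Fin n → L) :
    χ ^ n * Ω s = (Matrix.of fun i j => ε j (s i)).det * Ω e := by
  have h₁ := congrArg (fun f => f (fun i j => ε j (s i)))
    ((Ω.compLinearMap (Fintype.linearCombination R e)).eq_smul_basis_det (Pi.basisFun R (Fin n)))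
  simp only [AlternatingMap.compLinearMap_apply, AlternatingMap.smul_apply, smul_eq_mul] at h₁
  have h₂ : (fun i => Fintype.linearCombination R e (fun j => ε j (s i))) =
      fun i => χ • s i := by
    ext i
    rw [Fintype.linearCombination_apply, h]
  have h₃ : (fun i => Fintype.linearCombination R e (Pi.basisFun R (Fin n) i)) = e := by
    ext i
    simp [Fintype.linearCombination_apply]
  have h₄ := Ω.map_smul_univ (fun _ => χ) s
  simp only [Finset.prod_const, Finset.card_univ, Fintype.card_fin, smul_eq_mul] at h₄
  have h₅ : (Pi.basisFun R (Fin n)).det (fun i j => ε j (s i)) =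
      (Matrix.of fun i j => ε j (s i)).det := by
    rw [Pi.basisFun_det_apply]
  rw [h₂, h₃, h₄, h₅] at h₁
  rw [h₁, mul_comm]

theorem smul_alternating_update (h : ∀ v, ∑ i, ε i v • e i = χ • v)
    (Ω : L [⋀^Fin n]→ₗ[R] R) (i : Fin n) (v : L) :
    χ * Ω (Function.update e i v) = ε i v * Ω e := by
  rw [← smul_eq_mul, ← Ω.map_update_smul, ← h, Ω.map_update_sum, Finset.sum_eq_single i]
  · simp
  · intro j _ hj
    rw [Ω.map_update_smul, Ω.map_eq_zero_of_eq _ (i := i) (j := j) _ hj.symm, smul_zero]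
    rw [Function.update_self, Function.update_of_ne hj]
  · simp

end Frame

/-! ### Local frames cut off to global sections. -/

section Geometry

variable {E F : Type*} [NormedAddCommGroup E] [NormedSpace ℝ E] [FiniteDimensional ℝ E]
  [NormedAddCommGroup F] [NormedSpace ℝ F] [FiniteDimensional ℝ F]
  {M : Type*} [TopologicalSpace M] [T2Space M] [ChartedSpace E M] [IsManifold 𝓘(ℝ, E) ∞ M]
  {A : M → Type*} [TopologicalSpace (Bundle.TotalSpace F A)]
  [∀ x, AddCommGroup (A x)] [∀ x, Module ℝ (A x)] [∀ x, TopologicalSpace (A x)]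
  [FiberBundle F A] [VectorBundle ℝ F A] [ContMDiffVectorBundle ∞ F A 𝓘(ℝ, E)]

open Topology Module

theorem exists_smoothFun_eventuallyEq {U : Set M} (hU : IsOpen U) {x : M} (hx : x ∈ U) {f : M → ℝ}
    (hf : ∀ y ∈ U, ContMDiffAt 𝓘(ℝ, E) 𝓘(ℝ, ℝ) ∞ f y) :
    ∃ g : SmoothFun E M, ∀ᶠ y in 𝓝 x, g y = f y := by
  obtain ⟨φ, hφ, -⟩ := (SmoothBumpFunction.nhds_basis_support (I := 𝓘(ℝ, E))
    (hU.mem_nhds hx)).mem_iff.1 (hU.mem_nhds hx)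
  refine ⟨⟨fun y => φ y * f y, contMDiff_of_tsupport fun y hy => ?_⟩, ?_⟩
  · exact φ.contMDiffAt.mul (hf y (hφ (tsupport_mul_subset_left hy)))
  · filter_upwards [φ.eventuallyEq_one] with y hy
    change φ y * f y = f y
    rw [hy, Pi.one_apply, one_mul]

variable (F A) in
/-- Smooth sections which form a frame on a neighbourhood `U` of a point, with the dual
frame, cut off by bump functions. -/
structure CutoffFrame (x : M) where
  U : Set M
  isOpen_U : IsOpen U
  mem_U : x ∈ U
  e : Fin (finrank ℝ F) → Sections E F A
  ε : Fin (finrank ℝ F) → Dual (SmoothFun E M) (Sections E F A)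
  χ : SmoothFun E M
  sum_smul : ∀ v, ∑ i, ε i v • e i = χ • v
  χ_eq : ∀ y ∈ U, χ y = 1
  basis : ∀ y ∈ U, Basis (Fin (finrank ℝ F)) ℝ (A y)
  basis_apply : ∀ y hy i, basis y hy i = e i y
  repr_apply : ∀ y hy i v, (basis y hy).repr (v y) i = ε i v y

variable (E F A) in
theorem nonempty_cutoffFrame (x : M) : Nonempty (CutoffFrame (E := E) F A x) := by
  let t := trivializationAt F A x
  let b := finBasis ℝ F
  have hx : t.baseSet ∈ 𝓝 x := t.open_baseSet.mem_nhds (FiberBundle.mem_baseSet_trivializationAt' x)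
  obtain ⟨φ, hφ, -⟩ := (SmoothBumpFunction.nhds_basis_support (I := 𝓘(ℝ, E)) hx).mem_iff.1 hx
  obtain ⟨U, hU, hUo, hxU⟩ := mem_nhds_iff.1 φ.eventuallyEq_one
  have hφU : ∀ y ∈ U, φ y = 1 := fun y hy => hU hy
  have hUt : ∀ y ∈ U, y ∈ t.baseSet := fun y hy => hφ (subset_tsupport _ (by
    rw [Function.mem_support, hφU y hy]; exact one_ne_zero))
  let e : Fin (finrank ℝ F) → Sections E F A := fun i =>
    ⟨(φ : M → ℝ) • t.localFrame b i, φ.contMDiff.contMDiffOn.smul_section_of_tsupport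
      t.open_baseSet hφ (t.contMDiffOn_localFrame_baseSet ∞ b i)⟩
  let ε : Fin (finrank ℝ F) → Dual (SmoothFun E M) (Sections E F A) := fun i =>
    { toFun v := ⟨fun y => φ y * t.localFrameCoeff 𝓘(ℝ, E) b i y (v y),
        contMDiff_of_tsupport fun y hy => φ.contMDiffAt.mul
          (contMDiffAt_localFrameCoeff b (hφ (tsupport_mul_subset_left hy))
            v.contMDiff.contMDiffAt i)⟩
      map_add' v w := by
        ext y
        change φ y * t.localFrameCoeff 𝓘(ℝ, E) b i y (v y + w y) = _ + _
        rw [map_add, mul_add]; rfl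
      map_smul' f v := by
        ext y
        change φ y * t.localFrameCoeff 𝓘(ℝ, E) b i y (f y • v y) =
          f y * (φ y * t.localFrameCoeff 𝓘(ℝ, E) b i y (v y))
        rw [map_smul, smul_eq_mul]; ring }
  let φ' : SmoothFun E M := ⟨φ, φ.contMDiff⟩
  -- The frame and the coframe each carry a factor `φ`, hence `χ = φ²`.
  refine ⟨⟨U, hUo, hxU, e, ε, φ' * φ', ?_, ?_, fun y hy => t.basisAt b (hUt y hy), ?_, ?_⟩⟩
  · intro v
    ext y
    have h₁ : (∑ i, ε i v • e i) y = ∑ i, (φ y * t.localFrameCoeff 𝓘(ℝ, E) b i y (v y)) •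
        (φ y • t.localFrame b i y) := by
      have := congrFun (map_sum (ContMDiffSection.coeAddHom 𝓘(ℝ, E) F ∞ A)
        (fun i => ε i v • e i) Finset.univ) y
      simp only [ContMDiffSection.coeAddHom_apply, Finset.sum_apply] at this
      exact this
    have h₂ : ((φ' * φ') • v) y = (φ y * φ y) • v y := rfl
    rw [h₁, h₂]
    by_cases hy : y ∈ t.baseSet
    · conv_rhs => rw [t.eq_sum_localFrameCoeff_smul (I := 𝓘(ℝ, E)) (b := b) (s := v) hy]
      rw [Finset.smul_sum]
      refine Finset.sum_congr rfl fun i _ => ?_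
      module
    · have : φ y = 0 := by
        by_contra h
        exact hy (hφ (subset_tsupport _ h))
      simp [this]
  · intro y hy
    change φ y * φ y = 1
    rw [hφU y hy, one_mul]
  · intro y hy i
    change _ = φ y • t.localFrame b i y
    rw [hφU y hy, one_smul, t.localFrame_apply_of_mem_baseSet b (hUt y hy)]
  · intro y hy i v
    change _ = φ y * t.localFrameCoeff 𝓘(ℝ, E) b i y (v y)
    rw [hφU y hy, one_mul, t.localFrameCoeff_apply_of_mem_baseSet b (hUt y hy)]

end Geometry

section Geometry

variable {E F : Type*} [NormedAddCommGroup E] [NormedSpace ℝ E] [FiniteDimensional ℝ E]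
  [NormedAddCommGroup F] [NormedSpace ℝ F] [FiniteDimensional ℝ F]
  {M : Type*} [TopologicalSpace M] [T2Space M] [ChartedSpace E M] [IsManifold 𝓘(ℝ, E) ∞ M]
  {A : M → Type*} [TopologicalSpace (Bundle.TotalSpace F A)]
  [∀ x, AddCommGroup (A x)] [∀ x, Module ℝ (A x)] [∀ x, TopologicalSpace (A x)]
  [FiberBundle F A] [VectorBundle ℝ F A] [ContMDiffVectorBundle ∞ F A 𝓘(ℝ, E)]

open Topology Module

theorem evalRingHom_apply (y : M) (f : SmoothFun E M) : ContMDiffMap.evalRingHom y f = f y := rfl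

theorem smoothFun_sum_apply {ι : Type*} (s : Finset ι) (f : ι → SmoothFun E M) (y : M) :
    (∑ i ∈ s, f i) y = ∑ i ∈ s, f i y := map_sum (ContMDiffMap.evalRingHom y) f s

/-! ### Top forms and densities at points of the frame's domain. -/

section Frame

variable {x : M} (fr : CutoffFrame (E := E) F A x) {y : M} (hy : y ∈ fr.U)

/-- The form `ε₁ ∧ … ∧ ε_N` of a frame. -/
def CutoffFrame.form : Sections E F A [⋀^Fin (finrank ℝ F)]→ₗ[SmoothFun E M] SmoothFun E M :=
  evalForm (exteriorPower.ιMulti _ _ fr.ε)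

theorem CutoffFrame.form_apply (s : Fin (finrank ℝ F) → Sections E F A) :
    fr.form s = (Matrix.of fun i j => fr.ε j (s i)).det := by
  simp [CutoffFrame.form, evalForm]

include hy

theorem CutoffFrame.form_apply_eq_det (s : Fin (finrank ℝ F) → Sections E F A) :
    fr.form s y = (fr.basis y hy).det (fun i => s i y) := by
  rw [fr.form_apply, ← evalRingHom_apply, RingHom.map_det, Basis.det_apply, ← Matrix.det_transpose]
  congr 1
  ext i j
  simp [Basis.toMatrix_apply, fr.repr_apply, evalRingHom_apply]

theorem CutoffFrame.form_e : fr.form fr.e y = 1 := by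
  rw [fr.form_apply_eq_det hy]
  have : (fun i => fr.e i y) = fr.basis y hy := by ext i; rw [fr.basis_apply]
  rw [this, Basis.det_self]

theorem CutoffFrame.alternating_apply
    (Ω : Sections E F A [⋀^Fin (finrank ℝ F)]→ₗ[SmoothFun E M] SmoothFun E M)
    (s : Fin (finrank ℝ F) → Sections E F A) : Ω s y = fr.form s y * Ω fr.e y := by
  have h := congrArg (ContMDiffMap.evalRingHom y) (smul_alternating_eq_det fr.sum_smul Ω s)
  rw [map_mul, map_mul, map_pow, evalRingHom_apply, evalRingHom_apply, evalRingHom_apply,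
    evalRingHom_apply, fr.χ_eq y hy, one_pow, one_mul, ← fr.form_apply] at h
  exact h

theorem CutoffFrame.form_update_e (i : Fin (finrank ℝ F)) (v : Sections E F A) :
    fr.form (Function.update fr.e i v) y = fr.ε i v y := by
  have h := congrArg (ContMDiffMap.evalRingHom y) (smul_alternating_update fr.sum_smul fr.form i v)
  rw [map_mul, map_mul, evalRingHom_apply, evalRingHom_apply, evalRingHom_apply, evalRingHom_apply,
    fr.χ_eq y hy, one_mul, fr.form_e hy, mul_one] at h
  exact h

theorem CutoffFrame.linearIndependent_e : LinearIndependent ℝ (fun i => fr.e i y) := by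
  have : (fun i => fr.e i y) = fr.basis y hy := by ext i; rw [fr.basis_apply]
  rw [this]
  exact (fr.basis y hy).linearIndependent

theorem CutoffFrame.form_ne_zero_iff (s : Fin (finrank ℝ F) → Sections E F A) :
    fr.form s y ≠ 0 ↔ LinearIndependent ℝ (fun i => s i y) := by
  rw [fr.form_apply_eq_det hy]
  constructor
  · intro h
    by_contra hs
    exact h ((fr.basis y hy).det.map_linearDependent _ hs)
  · intro h
    have := Module.Finite.of_basis (fr.basis y hy)
    have h' : LinearIndependent ℝ (fun i => s i y) ∧
        Submodule.span ℝ (Set.range fun i => s i y) = ⊤ :=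
      ⟨h, h.span_eq_top_of_card_eq_finrank' (by
        rw [finrank_eq_card_basis (fr.basis y hy)])⟩
    exact ((Basis.is_basis_iff_det (fr.basis y hy)).1 h').ne_zero

theorem CutoffFrame.ε_e (i j : Fin (finrank ℝ F)) :
    fr.ε i (fr.e j) y = if i = j then 1 else 0 := by
  rw [← fr.repr_apply y hy, ← fr.basis_apply y hy, Basis.repr_self, Finsupp.single_apply]
  simp [eq_comm]

/-- Apply `map_det` to the endomorphism carrying the frame to `v`. -/
theorem CutoffFrame.density_apply (μ : Density E F A) (v : Fin (finrank ℝ F) → A y) :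
    μ.toFun y v = |(fr.basis y hy).det v| * μ.toFun y (fun i => fr.e i y) := by
  let T := (fr.basis y hy).constr ℝ v
  have hT : ∀ i, T (fr.e i y) = v i := fun i => by
    rw [← fr.basis_apply y hy]; exact Basis.constr_basis _ _ _ _
  have h := μ.map_det y T (fun i => fr.e i y)
  simp only [hT] at h
  rw [h]
  have hd := (fr.basis y hy).det_comp T (fr.basis y hy)
  rw [Basis.det_self, mul_one] at hd
  rw [← hd]
  congr 3
  ext i
  rw [Function.comp_apply, fr.basis_apply, hT]

theorem CutoffFrame.density_ne_zero (μ : Density E F A) (v : Fin (finrank ℝ F) → A y)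
    (hv : LinearIndependent ℝ v) : μ.toFun y v ≠ 0 := by
  obtain ⟨w, hw⟩ := μ.nowhere_vanishing y
  rw [fr.density_apply hy] at hw ⊢
  refine mul_ne_zero (abs_ne_zero.2 ?_) (right_ne_zero_of_mul hw)
  have := Module.Finite.of_basis (fr.basis y hy)
  have h' : LinearIndependent ℝ v ∧ Submodule.span ℝ (Set.range v) = ⊤ :=
    ⟨hv, hv.span_eq_top_of_card_eq_finrank' (by rw [finrank_eq_card_basis (fr.basis y hy)])⟩
  exact ((Basis.is_basis_iff_det (fr.basis y hy)).1 h').ne_zero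

end Frame

theorem section_eq_zero_of_forall_dual (v : Sections E F A)
    (h : ∀ γ : Dual (SmoothFun E M) (Sections E F A), γ v = 0) : v = 0 := by
  ext x
  obtain ⟨fr⟩ := nonempty_cutoffFrame E F A x
  refine (fr.basis x fr.mem_U).repr.injective ?_
  ext i
  rw [fr.repr_apply, h]
  simp

theorem exists_section_apply_eq {x : M} (v : A x) : ∃ s : Sections E F A, s x = v := by
  obtain ⟨fr⟩ := nonempty_cutoffFrame E F A x
  refine ⟨∑ i, (fr.basis x fr.mem_U).repr v i • fr.e i, ?_⟩
  have := congrFun (map_sum (ContMDiffSection.coeAddHom 𝓘(ℝ, E) F ∞ A)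
    (fun i => (fr.basis x fr.mem_U).repr v i • fr.e i) Finset.univ) x
  simp only [ContMDiffSection.coeAddHom_apply, Finset.sum_apply, ContMDiffSection.coe_smul,
    Pi.smul_apply] at this
  rw [this]
  simp_rw [← fr.basis_apply x fr.mem_U]
  exact (fr.basis x fr.mem_U).sum_repr v

/-! ### The Lie derivative of a density. -/

/-- The derivative of `t ↦ Ω(s + t u)` at `t = 0`. -/
theorem hasDerivAt_alternating {n : ℕ}
    (Ω : Sections E F A [⋀^Fin n]→ₗ[SmoothFun E M] SmoothFun E M)
    (s u : Fin n → Sections E F A) (y : M) :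
    HasDerivAt (fun t : ℝ => Ω (fun i => s i + t • u i) y)
      (∑ i, Ω (Function.update s i (u i)) y) 0 := by
  have hsm : ∀ (t : ℝ) (v : Sections E F A), t • v = algebraMap ℝ (SmoothFun E M) t • v :=
    fun t v => by ext y; rfl
  -- Multilinear expansion by the set `S` of slots where `u` is chosen; sets with at least two
  -- elements contribute nothing to the derivative at `0`.
  have h : ∀ t : ℝ, Ω (fun i => s i + t • u i) y =
      Ω s y + t * ∑ i, Ω (Function.update s i (u i)) y +
      ∑ S : Finset (Fin n) with 2 ≤ S.card, t ^ S.card * Ω (S.piecewise u s) y := by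
    intro t
    have h₁ := Ω.toMultilinearMap.map_add_eq_map_add_linearDeriv_add s (fun i => t • u i)
    have h₂ := congrArg (ContMDiffMap.evalRingHom y) h₁
    simp only [map_add, map_sum, MultilinearMap.linearDeriv_apply, evalRingHom_apply] at h₂
    refine h₂.trans ?_
    rw [Finset.mul_sum]
    refine congrArg₂ _ (congrArg₂ _ rfl ?_) ?_
    · refine Finset.sum_congr rfl fun i _ => ?_
      rw [hsm, AlternatingMap.coe_multilinearMap, Ω.map_update_smul]
      rfl
    · refine Finset.sum_congr rfl fun S _ => ?_
      have h₃ := Ω.toMultilinearMap.map_piecewise_smul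
        (fun _ => algebraMap ℝ (SmoothFun E M) t) (S.piecewise u s) S
      have h₄ : S.piecewise (fun i => algebraMap ℝ (SmoothFun E M) t • S.piecewise u s i)
          (S.piecewise u s) = S.piecewise (fun i => t • u i) s := by
        ext i : 1
        by_cases hi : i ∈ S <;> simp [hi, hsm]
      rw [h₄, Finset.prod_const, ← map_pow] at h₃
      rw [h₃]
      rfl
  simp only [h]
  have h5 : HasDerivAt (fun t : ℝ => ∑ S : Finset (Fin n) with 2 ≤ S.card,
      t ^ S.card * Ω (S.piecewise u s) y) 0 0 := by
    have : (0 : ℝ) = ∑ S : Finset (Fin n) with 2 ≤ S.card, (0 : ℝ) := by simp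
    rw [this]
    refine HasDerivAt.fun_sum fun S hS => ?_
    have h6 := (hasDerivAt_pow S.card (0 : ℝ)).mul_const (Ω (S.piecewise u s) y)
    simp only [Finset.mem_filter] at hS
    rw [zero_pow (by omega), mul_zero, zero_mul] at h6
    simpa using h6
  have h7 := (((hasDerivAt_id (0 : ℝ)).mul_const
    (∑ i, Ω (Function.update s i (u i)) y)).const_add (Ω s y)).add h5
  rw [one_mul, add_zero] at h7
  exact h7

variable [LieAlgebroid E F A]

theorem lie_apply_eq (V : Sections E F A) (f : SmoothFun E M) (y : M) :
    ⁅V, f⁆ y = dirDeriv f y ((LieAlgebroid.anchor : Anchor E F A).toFun y (V y)) := rfl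

theorem lie_apply_congr (V : Sections E F A) {f g : SmoothFun E M} {y : M}
    (h : ∀ᶠ z in 𝓝 y, f z = g z) : ⁅V, f⁆ y = ⁅V, g⁆ y := by
  have h' : (f : M → ℝ) =ᶠ[𝓝 y] g := h
  rw [lie_apply_eq, lie_apply_eq, dirDeriv, dirDeriv, h'.mfderiv_eq]
  rfl

/-- No sign condition is needed, as `Real.log` is `log |·|`. This also accommodates densities with
negative values. -/
theorem dirDeriv_log {f : M → ℝ} {y : M} (hf : MDifferentiableAt 𝓘(ℝ, E) 𝓘(ℝ, ℝ) f y)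
    (h : f y ≠ 0) (v : TangentSpace 𝓘(ℝ, E) y) :
    dirDeriv (fun z => Real.log (f z)) y v = dirDeriv f y v / f y := by
  have h₁ := (Real.hasDerivAt_log h).hasFDerivAt.hasMFDerivAt.comp y hf.hasMFDerivAt
  have h₂ : dirDeriv (fun z => Real.log (f z)) y v = (f y)⁻¹ * dirDeriv f y v := by
    unfold dirDeriv
    have := congrArg (fun T => T v) h₁.mfderiv
    refine this.trans ?_
    have h₂ : ∀ w : ℝ, ContinuousLinearMap.toSpanSingleton ℝ (f y)⁻¹ w = (f y)⁻¹ * w := fun w => by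
      rw [ContinuousLinearMap.toSpanSingleton_apply, smul_eq_mul, mul_comm]
    exact h₂ _
  rw [h₂]; ring

/-- The Lie derivative of a density which is locally `h |Ω|` with `log |h| = G`. -/
theorem Density.lie_eq (μ : Density E F A) {y : M}
    (Ω : Sections E F A [⋀^Fin (finrank ℝ F)]→ₗ[SmoothFun E M] SmoothFun E M) {h : M → ℝ}
    {G : SmoothFun E M}
    (hμ : ∀ᶠ z in 𝓝 y, ∀ s : Fin (finrank ℝ F) → Sections E F A,
      μ.toFun z (fun i => s i z) = |Ω s z| * h z)
    (hG : ∀ᶠ z in 𝓝 y, Real.log (h z) = G z) (hh : h y ≠ 0)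
    (s : Fin (finrank ℝ F) → Sections E F A) (hs : LinearIndependent ℝ (fun i => s i y))
    (V : Sections E F A) (hΩ : Ω s y ≠ 0) :
    μ.lie V s y = μ.toFun y (fun i => s i y) * (⁅V, G⁆ y + lieAlternating V Ω s y / Ω s y) := by
  have hμy := hμ.self_of_nhds
  have hne : μ.toFun y (fun i => s i y) ≠ 0 := by
    rw [hμy]; exact mul_ne_zero (abs_ne_zero.2 hΩ) hh
  have h₁ : dirDeriv (fun z => μ.toFun z (fun i => s i z)) y
      ((LieAlgebroid.anchor : Anchor E F A).toFun y (V y)) =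
      μ.toFun y (fun i => s i y) * (⁅V, G⁆ y + ⁅V, Ω s⁆ y / Ω s y) := by
    have hd := (μ.smooth' s y hs).mdifferentiableAt (by simp)
    have hl := dirDeriv_log hd hne ((LieAlgebroid.anchor : Anchor E F A).toFun y (V y))
    rw [eq_div_iff hne] at hl
    rw [← hl, mul_comm]
    congr 1
    have hΩd := SmoothFun.mdifferentiableAt (Ω s) y
    -- Taking logarithms turns the product into a sum and absorbs the absolute value of `Ω s`.
    have he : (fun z => Real.log (μ.toFun z (fun i => s i z))) =ᶠ[𝓝 y]
        (⇑G + fun z => Real.log (Ω s z)) := by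
      filter_upwards [hμ, hG, hd.continuousAt.eventually_ne hne] with z h₁ h₂ h₃
      rw [h₁] at h₃ ⊢
      rw [Real.log_mul (left_ne_zero_of_mul h₃) (right_ne_zero_of_mul h₃), Real.log_abs, h₂,
        add_comm]
      rfl
    have hlog : MDifferentiableAt 𝓘(ℝ, E) 𝓘(ℝ, ℝ) (fun z => Real.log (Ω s z)) y :=
      ((Real.hasDerivAt_log hΩ).hasFDerivAt.hasMFDerivAt.comp y hΩd.hasMFDerivAt).mdifferentiableAt
    rw [dirDeriv, he.mfderiv_eq, mfderiv_add (SmoothFun.mdifferentiableAt G y) hlog]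
    have := dirDeriv_log hΩd hΩ ((LieAlgebroid.anchor : Anchor E F A).toFun y (V y))
    rw [lie_apply_eq V (Ω s), ← this]
    rfl
  have h₂ : HasDerivAt
      (fun t : ℝ => μ.toFun y (fun i => s i y + t • (⁅V, s i⁆ : Sections E F A) y))
      (μ.toFun y (fun i => s i y) * ((∑ i, Ω (Function.update s i ⁅V, s i⁆) y) / Ω s y)) 0 := by
    have hq := hasDerivAt_alternating Ω s (fun i => ⁅V, s i⁆) y
    have h₀ : (fun i => s i + (0 : ℝ) • ⁅V, s i⁆) = s := by ext i : 1; rw [zero_smul, add_zero]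
    have ha := ((hasDerivAt_abs (x := Ω (fun i => s i + (0 : ℝ) • ⁅V, s i⁆) y)
      (by rwa [h₀])).comp 0 hq).mul_const (h y)
    rw [h₀] at ha
    have hf : (fun t : ℝ => μ.toFun y (fun i => s i y + t • (⁅V, s i⁆ : Sections E F A) y)) =
        fun t => |Ω (fun i => s i + t • ⁅V, s i⁆) y| * h y :=
      funext fun t => hμy (fun i => s i + t • ⁅V, s i⁆)
    rw [hf]
    refine ha.congr_deriv ?_
    rw [hμy, ← sign_mul_self]
    field_simp
  rw [Density.lie, h₁, h₂.deriv, lieAlternating_apply]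
  have h₃ : (⁅V, Ω s⁆ - ∑ i, Ω (Function.update s i ⁅V, s i⁆)) y =
      ⁅V, Ω s⁆ y - ∑ i, Ω (Function.update s i ⁅V, s i⁆) y := by
    rw [← smoothFun_sum_apply]; rfl
  rw [h₃]
  ring

theorem lie_one (V : Sections E F A) : ⁅V, (1 : SmoothFun E M)⁆ = 0 := by
  have h := LieRinehartRing.leibniz_mul_right V (1 : SmoothFun E M) 1
  simpa using h

section Frame

variable {x : M} (fr : CutoffFrame (E := E) F A x)

theorem CutoffFrame.exists_log (μ : Density E F A) :
    ∃ G : SmoothFun E M, ∀ᶠ z in 𝓝 x, Real.log (μ.toFun z (fun i => fr.e i z)) = G z := by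
  obtain ⟨G, hG⟩ := exists_smoothFun_eventuallyEq (E := E) fr.isOpen_U fr.mem_U
    (f := fun z => Real.log (μ.toFun z (fun i => fr.e i z))) fun y hy =>
      (Real.contDiffAt_log.2
        (fr.density_ne_zero hy μ _ (fr.linearIndependent_e hy))).contMDiffAt.comp y (μ.smooth' fr.e y (fr.linearIndependent_e hy))
  exact ⟨G, hG.mono fun z hz => hz.symm⟩

/-- The divergence with respect to the density `exp G |ε₁ ∧ … ∧ ε_N|`. -/
def CutoffFrame.divergence (G : SmoothFun E M) (V : Sections E F A) : SmoothFun E M :=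
  ⁅V, G⁆ - ∑ i, fr.ε i ⁅V, fr.e i⁆

theorem CutoffFrame.divergence_apply (G : SmoothFun E M) (V : Sections E F A) (y : M) :
    fr.divergence G V y = ⁅V, G⁆ y - ∑ i, fr.ε i ⁅V, fr.e i⁆ y := by
  rw [← smoothFun_sum_apply]; rfl

theorem CutoffFrame.lieAlternating_form {y : M} (hy : y ∈ fr.U) (V : Sections E F A) :
    lieAlternating V fr.form fr.e y = -∑ i, fr.ε i ⁅V, fr.e i⁆ y := by
  have h₁ : ⁅V, fr.form fr.e⁆ y = 0 := by
    rw [lie_apply_congr V (g := 1), lie_one]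
    · rfl
    · filter_upwards [fr.isOpen_U.mem_nhds hy] with z hz using fr.form_e hz
  rw [lieAlternating_apply, ← evalRingHom_apply, map_sub, map_sum, evalRingHom_apply, h₁, zero_sub]
  simp only [evalRingHom_apply, fr.form_update_e hy]

/-- The factor does not depend on `s`: the Lie derivative of the frame's top form is again a top
form, so its ratio to that form is the same on every basis. -/
theorem CutoffFrame.density_lie (μ : Density E F A) {G : SmoothFun E M}
    (hG : ∀ᶠ z in 𝓝 x, Real.log (μ.toFun z (fun i => fr.e i z)) = G z) :
    ∀ᶠ y in 𝓝 x, ∀ (V : Sections E F A) (s : Fin (finrank ℝ F) → Sections E F A),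
      LinearIndependent ℝ (fun i => s i y) →
        μ.lie V s y = fr.divergence G V y * μ.toFun y (fun i => s i y) := by
  filter_upwards [hG.eventually_nhds, fr.isOpen_U.mem_nhds fr.mem_U] with y hGy hy V s hs
  have hΩ := (fr.form_ne_zero_iff hy s).2 hs
  rw [μ.lie_eq fr.form (h := fun z => μ.toFun z (fun i => fr.e i z)) ?_ hGy
    (fr.density_ne_zero hy μ _ (fr.linearIndependent_e hy)) s hs V hΩ,
    fr.alternating_apply hy (lieAlternating V fr.form), mul_div_cancel_left₀ _ hΩ,
    fr.lieAlternating_form hy, fr.divergence_apply]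
  · ring
  · filter_upwards [fr.isOpen_U.mem_nhds hy] with z hz s
    rw [fr.density_apply hz, fr.form_apply_eq_det hz]

end Frame

/-! ### The divergence of a density. -/

/-- The divergence of a section with respect to a density. -/
def Density.divergenceAt (μ : Density E F A) (V : Sections E F A) (x : M) : ℝ :=
  let fr := (nonempty_cutoffFrame E F A x).some
  μ.lie V fr.e x / μ.toFun x (fun i => fr.e i x)

/-- The frame chosen at each point is irrelevant, so near `x` a single frame computes the
divergence; this gives smoothness and permits differentiation. -/
theorem Density.divergenceAt_eventuallyEq (μ : Density E F A) {x : M}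
    (fr : CutoffFrame (E := E) F A x) {G : SmoothFun E M}
    (hG : ∀ᶠ z in 𝓝 x, Real.log (μ.toFun z (fun i => fr.e i z)) = G z) :
    ∀ᶠ y in 𝓝 x, ∀ V, μ.divergenceAt V y = fr.divergence G V y := by
  filter_upwards [fr.density_lie μ hG] with y hy V
  let fr' := (nonempty_cutoffFrame E F A y).some
  have hs := fr'.linearIndependent_e fr'.mem_U
  change μ.lie V fr'.e y / μ.toFun y (fun i => fr'.e i y) = _
  rw [hy V fr'.e hs, mul_div_cancel_right₀ _ (fr'.density_ne_zero fr'.mem_U μ _ hs)]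

/-- The divergence of a section with respect to a density, as a smooth function. -/
def Density.divergence (μ : Density E F A) (V : Sections E F A) : SmoothFun E M where
  val := μ.divergenceAt V
  property x := by
    obtain ⟨fr⟩ := nonempty_cutoffFrame E F A x
    obtain ⟨G, hG⟩ := fr.exists_log μ
    exact (fr.divergence G V).contMDiff.contMDiffAt.congr_of_eventuallyEq
      ((μ.divergenceAt_eventuallyEq fr hG).mono fun y hy => hy V)

theorem Density.divergence_eventuallyEq (μ : Density E F A) {x : M}
    (fr : CutoffFrame (E := E) F A x) {G : SmoothFun E M}
    (hG : ∀ᶠ z in 𝓝 x, Real.log (μ.toFun z (fun i => fr.e i z)) = G z) :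
    ∀ᶠ y in 𝓝 x, ∀ V, μ.divergence V y = fr.divergence G V y :=
  μ.divergenceAt_eventuallyEq fr hG

theorem Density.lie_eq_divergence_mul (μ : Density E F A) (V : Sections E F A)
    (s : Fin (finrank ℝ F) → Sections E F A) (x : M) (hs : LinearIndependent ℝ (fun i => s i x)) :
    μ.lie V s x = μ.divergence V x * μ.toFun x (fun i => s i x) := by
  obtain ⟨fr⟩ := nonempty_cutoffFrame E F A x
  obtain ⟨G, hG⟩ := fr.exists_log μ
  rw [(fr.density_lie μ hG).self_of_nhds V s hs, (μ.divergence_eventuallyEq fr hG).self_of_nhds V]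

/-- Let `B_V` be the matrix of `εᵢ([V, eⱼ])`. By the Jacobi identity `B_{[V,W]} = V·B_W - W·B_V +
[B_V, B_W]` at `x`, and the commutator has trace zero. -/
theorem CutoffFrame.sum_ε_lie {x : M} (fr : CutoffFrame (E := E) F A x) (V W : Sections E F A) :
    ∑ i, fr.ε i ⁅⁅V, W⁆, fr.e i⁆ x =
      ⁅V, ∑ i, fr.ε i ⁅W, fr.e i⁆⁆ x - ⁅W, ∑ i, fr.ε i ⁅V, fr.e i⁆⁆ x := by
  have key : ∀ (V w : Sections E F A) (i : Fin (finrank ℝ F)), fr.ε i ⁅V, w⁆ x =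
      ∑ j, (fr.ε j w x * fr.ε i ⁅V, fr.e j⁆ x) + ⁅V, fr.ε i w⁆ x := by
    intro V w i
    -- `χ` is `1` near `x`, so the cutoff does not affect derivatives at `x`.
    have hχ : ⁅V, fr.χ⁆ x = 0 := by
      rw [lie_apply_congr V (g := 1), lie_one]
      · rfl
      · filter_upwards [fr.isOpen_U.mem_nhds fr.mem_U] with z hz using fr.χ_eq z hz
    have hV : ⁅V, ∑ j, fr.ε j w • fr.e j⁆ = ∑ j, ⁅V, fr.ε j w • fr.e j⁆ :=
      map_sum (AddMonoidHom.mk' (fun r : Sections E F A => ⁅V, r⁆) (fun r s => lie_add V r s)) _ _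
    have h := congrArg (fun u => ContMDiffMap.evalRingHom x (fr.ε i ⁅V, u⁆)) (fr.sum_smul w)
    simp only [hV, LieRinehartRing.leibniz_smul_right, map_add, map_sum, map_smul, smul_eq_mul,
      map_mul, evalRingHom_apply, hχ, fr.χ_eq x fr.mem_U, fr.ε_e fr.mem_U, one_mul, zero_mul,
      add_zero, Finset.sum_add_distrib, mul_ite, mul_one, mul_zero, Finset.sum_ite_eq,
      Finset.mem_univ, if_true] at h
    exact h.symm
  have hV : ∀ (V : Sections E F A) (f : Fin (finrank ℝ F) → SmoothFun E M),
      ⁅V, ∑ i, f i⁆ = ∑ i, ⁅V, f i⁆ := fun V f =>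
    map_sum (AddMonoidHom.mk' (fun r : SmoothFun E M => ⁅V, r⁆) (fun r s => lie_add V r s)) f _
  have h : ∀ i, fr.ε i ⁅⁅V, W⁆, fr.e i⁆ x =
      fr.ε i ⁅V, ⁅W, fr.e i⁆⁆ x - fr.ε i ⁅W, ⁅V, fr.e i⁆⁆ x := by
    intro i
    rw [lie_lie, map_sub]; rfl
  simp only [h, hV, smoothFun_sum_apply, Finset.sum_sub_distrib, key _ ⁅_, _⁆,
    Finset.sum_add_distrib]
  rw [Finset.sum_comm]
  simp only [mul_comm]
  ring

theorem Density.isDivergence (μ : Density E F A) : IsDivergence μ.divergence where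
  apply_add V W := by
    ext x
    obtain ⟨fr⟩ := nonempty_cutoffFrame E F A x
    obtain ⟨G, hG⟩ := fr.exists_log μ
    have h := (μ.divergence_eventuallyEq fr hG).self_of_nhds
    change _ = μ.divergence V x + μ.divergence W x
    rw [h, h, h]
    simp only [CutoffFrame.divergence, add_lie, map_add, Finset.sum_add_distrib,
      ← evalRingHom_apply, map_sub]
    ring
  apply_smul f V := by
    ext x
    obtain ⟨fr⟩ := nonempty_cutoffFrame E F A x
    obtain ⟨G, hG⟩ := fr.exists_log μ
    have h := (μ.divergence_eventuallyEq fr hG).self_of_nhds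
    change _ = f x * μ.divergence V x + ⁅V, f⁆ x
    have hs : ∑ i, ⁅fr.e i, f⁆ x * fr.ε i V x = ⁅V, f⁆ x := by
      have h₁ := congrArg (fun u : Sections E F A => ⁅u, f⁆ x) (fr.sum_smul V)
      have h₂ : ⁅∑ i, fr.ε i V • fr.e i, f⁆ = ∑ i, ⁅fr.ε i V • fr.e i, f⁆ :=
        map_sum (AddMonoidHom.mk' (fun r : Sections E F A => ⁅r, f⁆) (fun r s => add_lie r s f)) _ _
      simp only [h₂, LieRinehartRing.lie_smul_eq_mul, ← evalRingHom_apply, map_sum, map_mul] at h₁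
      simp only [evalRingHom_apply, fr.χ_eq x fr.mem_U, one_mul] at h₁
      rw [← h₁]
      exact Finset.sum_congr rfl fun i _ => mul_comm _ _
    rw [h, h, ← hs]
    simp only [CutoffFrame.divergence, smul_lie_eq, LieRinehartRing.lie_smul_eq_mul, map_sub,
      map_smul, smul_eq_mul, Finset.sum_sub_distrib, ← evalRingHom_apply, map_mul, map_sum]
    rw [← Finset.mul_sum]
    ring
  apply_lie V W := by
    ext x
    obtain ⟨fr⟩ := nonempty_cutoffFrame E F A x
    obtain ⟨G, hG⟩ := fr.exists_log μ
    have h := μ.divergence_eventuallyEq fr hG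
    change _ = ⁅V, μ.divergence W⁆ x - ⁅W, μ.divergence V⁆ x
    rw [h.self_of_nhds, lie_apply_congr V (h.mono fun y hy => hy W),
      lie_apply_congr W (h.mono fun y hy => hy V), fr.divergence_apply, fr.sum_ε_lie]
    simp only [CutoffFrame.divergence, lie_sub, lie_lie, ← evalRingHom_apply, map_sub]
    ring

/-! ### The section `X` of a density, and change of density. -/

theorem Density.isSectionX_iff (μ : Density E F A) (π : ⋀[SmoothFun E M]^2 (Sections E F A))
    (X : Sections E F A) :
    μ.IsSectionX π X ↔ ∀ α : Dual (SmoothFun E M) (Sections E F A),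
      α X = μ.divergence (sharp π α) - contractTwoForm π (differentialOne α) := by
  constructor
  · intro h α
    ext x
    obtain ⟨fr⟩ := nonempty_cutoffFrame E F A x
    have hs := fr.linearIndependent_e fr.mem_U
    have h₁ := h α fr.e x hs
    rw [μ.lie_eq_divergence_mul _ _ _ hs, ← sub_mul] at h₁
    exact mul_right_cancel₀ (fr.density_ne_zero fr.mem_U μ _ hs) h₁
  · intro h α s x hs
    rw [μ.lie_eq_divergence_mul _ _ _ hs, ← sub_mul, h α]
    rfl

theorem Density.existsUnique_section (μ : Density E F A)
    (π : ⋀[SmoothFun E M]^2 (Sections E F A)) : ∃! X, μ.IsSectionX π X := by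
  simp only [μ.isSectionX_iff]
  obtain ⟨X, hX⟩ := μ.isDivergence.exists_section π
  refine ⟨X, hX, fun Y hY => ?_⟩
  rw [← sub_eq_zero]
  refine section_eq_zero_of_forall_dual _ fun γ => ?_
  rw [map_sub, hX, hY, sub_self]

theorem CutoffFrame.log_density_div {x y : M} (fr : CutoffFrame (E := E) F A x) (hy : y ∈ fr.U)
    (μ ν : Density E F A) {v : Fin (finrank ℝ F) → A y} (hv : LinearIndependent ℝ v) :
    Real.log (μ.toFun y v / ν.toFun y v) =
      Real.log (μ.toFun y (fun i => fr.e i y)) - Real.log (ν.toFun y (fun i => fr.e i y)) := by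
  have hμ := fr.density_ne_zero hy μ _ hv
  have he := fr.linearIndependent_e hy
  rw [fr.density_apply hy] at hμ
  rw [fr.density_apply hy μ v, fr.density_apply hy ν v,
    mul_div_mul_left _ _ (left_ne_zero_of_mul hμ),
    Real.log_div (fr.density_ne_zero hy μ _ he) (fr.density_ne_zero hy ν _ he)]

/-- The divergences of two densities differ by the derivative of the logarithm of their ratio. -/
theorem Density.exists_divergence_sub (μ ν : Density E F A) :
    ∃ f : SmoothFun E M, ∀ V, μ.divergence V - ν.divergence V = ⁅V, f⁆ := by
  -- The ratio of two densities is the same on every basis, since the factors `|det|` cancel; hence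
  -- the pointwise choice of frame still gives a smooth function.
  let f₀ : M → ℝ := fun x =>
    let fr := (nonempty_cutoffFrame E F A x).some
    Real.log (μ.toFun x (fun i => fr.e i x) / ν.toFun x (fun i => fr.e i x))
  have hf₀ : ∀ (x : M) (fr : CutoffFrame (E := E) F A x) (G H : SmoothFun E M),
      (∀ᶠ z in 𝓝 x, Real.log (μ.toFun z (fun i => fr.e i z)) = G z) →
      (∀ᶠ z in 𝓝 x, Real.log (ν.toFun z (fun i => fr.e i z)) = H z) →
      ∀ᶠ z in 𝓝 x, f₀ z = (G - H) z := by
    intro x fr G H hG hH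
    filter_upwards [hG, hH, fr.isOpen_U.mem_nhds fr.mem_U] with z hGz hHz hz
    have hs := (nonempty_cutoffFrame E F A z).some.linearIndependent_e
      (nonempty_cutoffFrame E F A z).some.mem_U
    refine (fr.log_density_div hz μ ν hs).trans ?_
    rw [hGz, hHz]; rfl
  have hsm : ContMDiff 𝓘(ℝ, E) 𝓘(ℝ, ℝ) ∞ f₀ := fun x => by
    obtain ⟨fr⟩ := nonempty_cutoffFrame E F A x
    obtain ⟨G, hG⟩ := fr.exists_log μ
    obtain ⟨H, hH⟩ := fr.exists_log ν
    exact (G - H).contMDiff.contMDiffAt.congr_of_eventuallyEq (hf₀ x fr G H hG hH)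
  obtain ⟨f, hf⟩ : ∃ f : SmoothFun E M, ∀ x, f x = f₀ x := ⟨⟨f₀, hsm⟩, fun _ => rfl⟩
  refine ⟨f, fun V => ?_⟩
  ext x
  obtain ⟨fr⟩ := nonempty_cutoffFrame E F A x
  obtain ⟨G, hG⟩ := fr.exists_log μ
  obtain ⟨H, hH⟩ := fr.exists_log ν
  change μ.divergence V x - ν.divergence V x = _
  rw [lie_apply_congr V (g := G - H) ((hf₀ x fr G H hG hH).mono fun y hy => (hf y).trans hy),
    (μ.divergence_eventuallyEq fr hG).self_of_nhds, (ν.divergence_eventuallyEq fr hH).self_of_nhds,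
    fr.divergence_apply, fr.divergence_apply, lie_sub]
  simp only [← evalRingHom_apply, map_sub]
  ring

/-! ### Volume forms and their absolute values. -/

theorem CutoffFrame.alternating_apply_congr {x y : M} (fr : CutoffFrame (E := E) F A x)
    (hy : y ∈ fr.U) (Ω : Sections E F A [⋀^Fin (finrank ℝ F)]→ₗ[SmoothFun E M] SmoothFun E M)
    {s t : Fin (finrank ℝ F) → Sections E F A} (h : ∀ i, s i y = t i y) : Ω s y = Ω t y := by
  rw [fr.alternating_apply hy, fr.alternating_apply hy Ω t, fr.form_apply_eq_det hy,
    fr.form_apply_eq_det hy]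
  simp only [h]

theorem VolumeForm.evalForm_ne_zero_iff (vol : VolumeForm E F A)
    (s : Fin (finrank ℝ F) → Sections E F A) (x : M) :
    evalForm vol.form s x ≠ 0 ↔ LinearIndependent ℝ (fun i => s i x) := by
  obtain ⟨fr⟩ := nonempty_cutoffFrame E F A x
  obtain ⟨t, ht⟩ := vol.nowhere_vanishing x
  rw [fr.alternating_apply fr.mem_U] at ht ⊢
  rw [← fr.form_ne_zero_iff fr.mem_U, mul_ne_zero_iff, and_iff_left (right_ne_zero_of_mul ht)]

/-- A family of sections with given values at a point. -/
def extendAt (x : M) (v : Fin (finrank ℝ F) → A x) : Fin (finrank ℝ F) → Sections E F A :=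
  fun i => (exists_section_apply_eq (E := E) (F := F) (v i)).choose

theorem extendAt_apply (x : M) (v : Fin (finrank ℝ F) → A x) (i : Fin (finrank ℝ F)) :
    extendAt (E := E) x v i x = v i :=
  (exists_section_apply_eq (E := E) (F := F) (v i)).choose_spec

theorem VolumeForm.abs_evalForm_extendAt (vol : VolumeForm E F A)
    (s : Fin (finrank ℝ F) → Sections E F A) (x : M) :
    |evalForm vol.form (extendAt x (fun i => s i x)) x| = |evalForm vol.form s x| := by
  obtain ⟨fr⟩ := nonempty_cutoffFrame E F A x
  rw [fr.alternating_apply_congr fr.mem_U _ (extendAt_apply x (fun i => s i x))]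

/-- The density `|vol|`. -/
def VolumeForm.density (vol : VolumeForm E F A) : Density E F A where
  toFun x v := |evalForm vol.form (extendAt x v) x|
  map_det x T v := by
    obtain ⟨fr⟩ := nonempty_cutoffFrame E F A x
    rw [fr.alternating_apply fr.mem_U, fr.alternating_apply fr.mem_U _ (extendAt x v),
      fr.form_apply_eq_det fr.mem_U, fr.form_apply_eq_det fr.mem_U, ← abs_mul, ← mul_assoc]
    simp only [extendAt_apply]
    rw [← Basis.det_comp]
    rfl
  smooth' s x hs := by
    simp only [vol.abs_evalForm_extendAt]
    exact (contDiffAt_abs ((vol.evalForm_ne_zero_iff s x).2 hs)).contMDiffAt.comp x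
      (evalForm vol.form s).contMDiff.contMDiffAt
  nowhere_vanishing x := by
    obtain ⟨s, hs⟩ := vol.nowhere_vanishing x
    exact ⟨fun i => s i x, by rw [vol.abs_evalForm_extendAt]; exact abs_ne_zero.2 hs⟩

theorem VolumeForm.density_apply (vol : VolumeForm E F A)
    (s : Fin (finrank ℝ F) → Sections E F A) (x : M) :
    vol.density.toFun x (fun i => s i x) = |evalForm vol.form s x| :=
  vol.abs_evalForm_extendAt s x

theorem VolumeForm.density_lie (vol : VolumeForm E F A) (V : Sections E F A)
    (s : Fin (finrank ℝ F) → Sections E F A) (x : M) (hs : LinearIndependent ℝ (fun i => s i x)) :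
    vol.density.lie V s x =
      |evalForm vol.form s x| * (lieForm V vol.form s x / evalForm vol.form s x) := by
  rw [vol.density.lie_eq (evalForm vol.form) (h := fun _ => 1) (G := 0) (.of_forall fun z s => ?_)
    (.of_forall fun z => Real.log_one) one_ne_zero s hs V ((vol.evalForm_ne_zero_iff s x).2 hs),
    vol.density_apply, lie_zero]
  · exact congrArg _ (zero_add _)
  · rw [vol.density_apply, mul_one]

/-- A form and its absolute value have the same logarithmic Lie derivative on a basis. -/
theorem VolumeForm.isSectionX_iff (vol : VolumeForm E F A)
    (π : ⋀[SmoothFun E M]^2 (Sections E F A)) (X : Sections E F A) :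
    IsSectionX π vol.form X ↔ vol.density.IsSectionX π X := by
  have hx : ∀ (α : Dual (SmoothFun E M) (Sections E F A))
      (s : Fin (finrank ℝ F) → Sections E F A) (x : M), LinearIndependent ℝ (fun i => s i x) →
      (α X x * vol.density.toFun x (fun i => s i x) = vol.density.lie (sharp π α) s x -
          contractTwoForm π (differentialOne α) x * vol.density.toFun x (fun i => s i x) ↔
        α X x * evalForm vol.form s x = lieForm (sharp π α) vol.form s x -
          contractTwoForm π (differentialOne α) x * evalForm vol.form s x) := by
    intro α s x hs
    have h := (vol.evalForm_ne_zero_iff s x).2 hs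
    rw [vol.density_apply, vol.density_lie _ _ _ hs, mul_comm (α X x),
      mul_comm (contractTwoForm π (differentialOne α) x), ← mul_sub,
      mul_right_inj' (abs_ne_zero.2 h), eq_sub_iff_add_eq, eq_div_iff h, eq_sub_iff_add_eq, add_mul]
  constructor
  · intro h α s x hs
    exact (hx α s x hs).2 (congrArg (ContMDiffMap.evalRingHom x) (h α s))
  · intro h α s
    ext x
    by_cases hs : LinearIndependent ℝ (fun i => s i x)
    · exact (hx α s x hs).1 (h α s x hs)
    -- The density condition says nothing about dependent sections; there the form and its Lie
    -- derivative both vanish.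
    · obtain ⟨fr⟩ := nonempty_cutoffFrame E F A x
      have h₀ : fr.form s x = 0 := by
        by_contra h₀
        exact hs ((fr.form_ne_zero_iff fr.mem_U s).1 h₀)
      have h₁ : evalForm vol.form s x = 0 := by
        rw [fr.alternating_apply fr.mem_U, h₀, zero_mul]
      have h₂ : lieForm (sharp π α) vol.form s x = 0 := by
        change lieAlternating (sharp π α) (evalForm vol.form) s x = 0
        rw [fr.alternating_apply fr.mem_U, h₀, zero_mul]
      change α X x * evalForm vol.form s x = lieForm (sharp π α) vol.form s x -
          contractTwoForm π (differentialOne α) x * evalForm vol.form s x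
      rw [h₁, h₂]; ring

/-! ### The modular class. -/

variable {π : ⋀[SmoothFun E M]^2 (Sections E F A)}
  {ψ : ⋀[SmoothFun E M]^3 (Dual (SmoothFun E M) (Sections E F A))}

theorem Density.add_sectionY_mem_cocycles (hπψ : IsTwistedPoisson π ψ) (μ : Density E F A)
    {X : Sections E F A} (hX : μ.IsSectionX π X) : X + sectionY π ψ ∈ cocycles π ψ :=
  μ.isDivergence.add_sectionY_mem_cocycles section_eq_zero_of_forall_dual hπψ
    ((μ.isSectionX_iff π X).1 hX)

theorem Density.cohomologyClass_eq (μ ν : Density E F A) {X Y : Sections E F A}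
    (hX : μ.IsSectionX π X) (hY : ν.IsSectionX π Y)
    (hX' : X + sectionY π ψ ∈ cocycles π ψ) (hY' : Y + sectionY π ψ ∈ cocycles π ψ) :
    cohomologyClass ⟨X + sectionY π ψ, hX'⟩ = cohomologyClass ⟨Y + sectionY π ψ, hY'⟩ := by
  -- The order `ν`, `μ` matches the difference `-(X + Y_{π,ψ}) + (Y + Y_{π,ψ})` tested in the
  -- quotient, which is then `d_{π,ψ} f`.
  obtain ⟨f, hf⟩ := ν.exists_divergence_sub μ
  refine QuotientAddGroup.eq.2 ⟨f, ?_⟩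
  change -(X + sectionY π ψ) + (Y + sectionY π ψ) = -sharp π (differentialZero f)
  rw [← sub_eq_zero]
  refine section_eq_zero_of_forall_dual _ fun γ => ?_
  have h := hf (sharp π γ)
  rw [map_sub, map_neg γ (sharp π _), apply_sharp, neg_neg, differentialZero_apply, ← h, map_add,
    map_neg, map_add, map_add, (μ.isSectionX_iff π X).1 hX, (ν.isSectionX_iff π Y).1 hY]
  ring

end Geometry

end TwistedPoisson

end

theorem mainTheorem2
    {E F : Type*} [NormedAddCommGroup E] [NormedSpace ℝ E] [FiniteDimensional ℝ E]
    [NormedAddCommGroup F] [NormedSpace ℝ F] [FiniteDimensional ℝ F]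
    {M : Type*} [TopologicalSpace M] [T2Space M] [SigmaCompactSpace M]
    [ChartedSpace E M] [IsManifold 𝓘(ℝ, E) ∞ M]
    {A : M → Type*} [TopologicalSpace (Bundle.TotalSpace F A)]
    [∀ x, AddCommGroup (A x)] [∀ x, Module ℝ (A x)] [∀ x, TopologicalSpace (A x)]
    [FiberBundle F A] [VectorBundle ℝ F A] [ContMDiffVectorBundle ∞ F A 𝓘(ℝ, E)]
    [TwistedPoisson.LieAlgebroid E F A]
    (π : ⋀[TwistedPoisson.SmoothFun E M]^2 (TwistedPoisson.Sections E F A))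
    (ψ : ⋀[TwistedPoisson.SmoothFun E M]^3
      (Module.Dual (TwistedPoisson.SmoothFun E M) (TwistedPoisson.Sections E F A)))
    (hπψ : TwistedPoisson.IsTwistedPoisson π ψ) :
    ∃ c : TwistedPoisson.cohomologyOne π ψ,
      (∀ vol : TwistedPoisson.VolumeForm E F A,
        (∃! X, TwistedPoisson.IsSectionX π vol.form X) ∧
        ∀ X, TwistedPoisson.IsSectionX π vol.form X →
          ∃ hZ : X + TwistedPoisson.sectionY π ψ ∈ TwistedPoisson.cocycles π ψ,
            TwistedPoisson.cohomologyClass ⟨X + TwistedPoisson.sectionY π ψ, hZ⟩ = c) ∧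
      (∀ μ : TwistedPoisson.Density E F A,
        (∃! X, μ.IsSectionX π X) ∧
        ∀ X, μ.IsSectionX π X →
          ∃ hZ : X + TwistedPoisson.sectionY π ψ ∈ TwistedPoisson.cocycles π ψ,
            TwistedPoisson.cohomologyClass ⟨X + TwistedPoisson.sectionY π ψ, hZ⟩ = c) := by
  by_cases hμ : Nonempty (TwistedPoisson.Density E F A)
  · obtain ⟨μ⟩ := hμ
    obtain ⟨X, hX, -⟩ := μ.existsUnique_section π
    have key : ∀ ν : TwistedPoisson.Density E F A, (∃! Y, ν.IsSectionX π Y) ∧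
        ∀ Y, ν.IsSectionX π Y →
          ∃ hZ : Y + TwistedPoisson.sectionY π ψ ∈ TwistedPoisson.cocycles π ψ,
            TwistedPoisson.cohomologyClass ⟨Y + TwistedPoisson.sectionY π ψ, hZ⟩ =
              TwistedPoisson.cohomologyClass
                ⟨X + TwistedPoisson.sectionY π ψ, μ.add_sectionY_mem_cocycles hπψ hX⟩ :=
      fun ν => ⟨ν.existsUnique_section π, fun Y hY =>
        ⟨ν.add_sectionY_mem_cocycles hπψ hY, ν.cohomologyClass_eq μ hY hX _ _⟩⟩
    refine ⟨_, fun vol => ?_, key⟩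
    simp only [vol.isSectionX_iff]
    exact key vol.density
  -- Without a density there is no volume form either, so both claims are vacuous and any class
  -- serves.
  · exact ⟨0, fun vol => (hμ ⟨vol.density⟩).elim, fun μ => (hμ ⟨μ⟩).elim⟩
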